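/- An instance of Balanced Stable Marriage consists of finite sets $M$ (men) and $W$ (women), where each person $a$ has a strict preference list of acceptable partners, chosen from the opposite side; $w$ is on the list of $m$ if and only if $m$ is on the list of $w$, and such a pair is called acceptable. Let $p_a(b)\in\{1,2,\dots\}$ be the position of $b$ in the list of $a$. A matching $\mu$ is a set of pairwise disjoint acceptable pairs $(m,w)\in M\times W$; it is stable if there is no acceptable pair $(m,w)$ such that $m$ is unmatched or $p_m(w)<p_m(\mu(m))$, and $w$ is unmatched or $p_w(m)<p_w(\mu(w))$. Let $$\mathrm{Bal}=\min_{\mu\text{ stable}}\max\Big\{\sum_{(m,w)\in\mu}p_m(w),\ \sum_{(m,w)\in\mu}p_w(m)\Big\},\qquad O_M=\sum_{(m,w)\in\mu_M}p_m(w),\qquad O_W=\sum_{(m,w)\in\mu_W}p_w(m),$$ where $\mu_M$ and $\mu_W$ are the man-optimal and the woman-optimal stable matching. In the problem Above-Min Balanced Stable Marriage (Above-Min BSM), the input is such an instance and a non-negative integer $k$ (in binary), the question is whether $\mathrm{Bal}\le k$, and the parameter is $t=k-\min\{O_M,O_W\}$. Theorem. Above-Min BSM can be solved in time $\mathcal{O}^*(8^t)$: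 there are a (deterministic) algorithm and a polynomial $p$ such that, for every input of size $N$, the algorithm correctly decides whether $\mathrm{Bal}\le k$ in at most $p(N)\cdot 8^{\max\{t,0\}}$ steps. -/

import Mathlib

namespace BSM

/-! ### Instances, stable matchings, balance -/

/-- An instance of (Balanced) Stable Marriage: finitely many men and women, each with a strict
preference list of acceptable partners (most preferred first); acceptability is mutual. -/
structure Instance where
  men : ℕ
  women : ℕ
  menPref : Fin men → List (Fin women)
  womenPref : Fin women → List (Fin men)
  menPref_nodup : ∀ m, (menPref m).Nodup
  womenPref_nodup : ∀ w, (womenPref w).Nodup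
  mem_iff : ∀ m w, w ∈ menPref m ↔ m ∈ womenPref w

namespace Instance

variable (I : Instance)

/-- `p_m(w)`: the position (starting from 1) of `w` in the list of `m`. -/
def menPos (m : Fin I.men) (w : Fin I.women) : ℕ := (I.menPref m).idxOf w + 1

/-- `p_w(m)`: the position (starting from 1) of `m` in the list of `w`. -/
def womenPos (w : Fin I.women) (m : Fin I.men) : ℕ := (I.womenPref w).idxOf m + 1

/-- `(m, w)` is an acceptable pair. -/
def Acceptable (m : Fin I.men) (w : Fin I.women) : Prop :=
  w ∈ I.menPref m ∧ m ∈ I.womenPref w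

/-- A matching, given as its set of pairs: all pairs are acceptable and nobody is in two pairs. -/
structure IsMatching (μ : Finset (Fin I.men × Fin I.women)) : Prop where
  acceptable : ∀ m w, (m, w) ∈ μ → I.Acceptable m w
  woman_unique : ∀ m w w', (m, w) ∈ μ → (m, w') ∈ μ → w = w'
  man_unique : ∀ m m' w, (m, w) ∈ μ → (m', w) ∈ μ → m = m'

/-- `(m, w)` blocks `μ`: it is an acceptable pair, `m` is unmatched or prefers `w` to his partner,
and `w` is unmatched or prefers `m` to her partner. -/
def Blocks (μ : Finset (Fin I.men × Fin I.women)) (m : Fin I.men) (w : Fin I.women) : Prop :=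
  I.Acceptable m w ∧
    ((∀ w', (m, w') ∉ μ) ∨ ∃ w', (m, w') ∈ μ ∧ I.menPos m w < I.menPos m w') ∧
    ((∀ m', (m', w) ∉ μ) ∨ ∃ m', (m', w) ∈ μ ∧ I.womenPos w m < I.womenPos w m')

/-- `μ` is a stable matching. -/
def IsStable (μ : Finset (Fin I.men × Fin I.women)) : Prop :=
  I.IsMatching μ ∧ ∀ m w, ¬ I.Blocks μ m w

/-- The total dissatisfaction of the men. -/
def menCost (μ : Finset (Fin I.men × Fin I.women)) : ℕ := ∑ e ∈ μ, I.menPos e.1 e.2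

/-- The total dissatisfaction of the women. -/
def womenCost (μ : Finset (Fin I.men × Fin I.women)) : ℕ := ∑ e ∈ μ, I.womenPos e.2 e.1

/-- The balance of a matching. -/
def balance (μ : Finset (Fin I.men × Fin I.women)) : ℕ := max (I.menCost μ) (I.womenCost μ)

/-- `Bal`: the minimum balance of a stable matching. -/
noncomputable def Bal : ℕ := sInf {b | ∃ μ, I.IsStable μ ∧ I.balance μ = b}

/-- `μ₀` is the man-optimal stable matching: in comparison with any stable matching `μ`, every man
is unmatched by both, or matched by both and at least as satisfied with `μ₀`. -/
def IsManOptimal (μ₀ : Finset (Fin I.men × Fin I.women)) : Prop :=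
  I.IsStable μ₀ ∧ ∀ μ, I.IsStable μ → ∀ m,
    ((∀ w, (m, w) ∉ μ₀) ∧ ∀ w, (m, w) ∉ μ) ∨
      ∃ w₀ w, (m, w₀) ∈ μ₀ ∧ (m, w) ∈ μ ∧ I.menPos m w₀ ≤ I.menPos m w

/-- `μ₀` is the woman-optimal stable matching. -/
def IsWomanOptimal (μ₀ : Finset (Fin I.men × Fin I.women)) : Prop :=
  I.IsStable μ₀ ∧ ∀ μ, I.IsStable μ → ∀ w,
    ((∀ m, (m, w) ∉ μ₀) ∧ ∀ m, (m, w) ∉ μ) ∨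
      ∃ m₀ m, (m₀, w) ∈ μ₀ ∧ (m, w) ∈ μ ∧ I.womenPos w m₀ ≤ I.womenPos w m

/-- `O_M`: the total dissatisfaction of the men in the man-optimal stable matching. (That matching
exists and is unique, so this is the infimum of a one-element set.) -/
noncomputable def OM : ℕ := sInf {c | ∃ μ, I.IsManOptimal μ ∧ I.menCost μ = c}

/-- `O_W`: the total dissatisfaction of the women in the woman-optimal stable matching. -/
noncomputable def OW : ℕ := sInf {c | ∃ μ, I.IsWomanOptimal μ ∧ I.womenCost μ = c}

/-- The parameter `t = k - min {O_M, O_W}`, an integer. -/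
noncomputable def param (k : ℕ) : ℤ := (k : ℤ) - min (I.OM : ℤ) (I.OW : ℤ)

end Instance

/-! ### Encoding of the input as a binary tree

Lists are right-nested pairs ending in the empty tree, men and women are named by their index
(as a list of that many empty trees), and `k` is written in binary, least significant bit first.
Every person contributes a node, so the size (the number of nodes) of the encoding is polynomially
related to the length of any other reasonable encoding of the preference lists and of `k` in
binary. -/

/-- The encoding of a list of trees. -/
def encList (l : List (BinaryTree Unit)) : BinaryTree Unit :=
  l.foldr (fun a b => BinaryTree.node () a b) BinaryTree.nil

/-- The encoding of a truth value. -/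
def encBool (b : Bool) : BinaryTree Unit :=
  if b then BinaryTree.node () BinaryTree.nil BinaryTree.nil else BinaryTree.nil

/-- The index of a person. -/
def encIndex (i : ℕ) : BinaryTree Unit := encList (List.replicate i BinaryTree.nil)

/-- A natural number in binary. -/
def encBinary (k : ℕ) : BinaryTree Unit := encList (k.bits.map encBool)

/-- A family of preference lists. -/
def encPref {a b : ℕ} (pref : Fin a → List (Fin b)) : BinaryTree Unit :=
  encList (List.ofFn fun i => encList ((pref i).map fun j => encIndex j))

/-- The encoding of an instance of Above-Min BSM. -/
def encode (I : Instance) (k : ℕ) : BinaryTree Unit :=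
  encList [encBinary k, encPref I.menPref, encPref I.womenPref]

/-! ### The machine model

Algorithms are programs of the usual WHILE language over binary trees ("cons cells"): finitely many
variables, each holding (a pointer to) a tree, and as elementary operations building one cell,
selecting one of the two components of a cell, copying a pointer and testing for the empty tree.
Each elementary operation takes one unit of time; `n` of them can be carried out in `O(n)` steps of
a random access machine. -/

/-- WHILE programs. Variables are numbered. -/
inductive Prog where
  /-- `x := nil` -/
  | nil (x : ℕ)
  /-- `x := y` -/
  | copy (x y : ℕ)
  /-- `x := cons y z` -/
  | cons (x y z : ℕ)
  /-- `x := hd y` -/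
  | hd (x y : ℕ)
  /-- `x := tl y` -/
  | tl (x y : ℕ)
  /-- `c; d` -/
  | seq (c d : Prog)
  /-- `if x ≠ nil then c else d` -/
  | ite (x : ℕ) (c d : Prog)
  /-- `while x ≠ nil do c` -/
  | loop (x : ℕ) (c : Prog)

/-- The contents of the variables. -/
abbrev Store := ℕ → BinaryTree Unit

/-- First component (of the empty tree: the empty tree). -/
def fstTree : BinaryTree Unit → BinaryTree Unit
  | BinaryTree.nil => BinaryTree.nil
  | BinaryTree.node _ a _ => a

/-- Second component (of the empty tree: the empty tree). -/
def sndTree : BinaryTree Unit → BinaryTree Unit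
  | BinaryTree.nil => BinaryTree.nil
  | BinaryTree.node _ _ b => b

/-- `Exec c s n s'`: the program `c`, started in the store `s`, halts in the store `s'` after
exactly `n` elementary operations (assignments and tests). -/
inductive Exec : Prog → Store → ℕ → Store → Prop
  | nil (x : ℕ) (s : Store) :
      Exec (Prog.nil x) s 1 (Function.update s x BinaryTree.nil)
  | copy (x y : ℕ) (s : Store) :
      Exec (Prog.copy x y) s 1 (Function.update s x (s y))
  | cons (x y z : ℕ) (s : Store) :
      Exec (Prog.cons x y z) s 1 (Function.update s x (BinaryTree.node () (s y) (s z)))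
  | hd (x y : ℕ) (s : Store) :
      Exec (Prog.hd x y) s 1 (Function.update s x (fstTree (s y)))
  | tl (x y : ℕ) (s : Store) :
      Exec (Prog.tl x y) s 1 (Function.update s x (sndTree (s y)))
  | seq {c d : Prog} {s s' s'' : Store} {n n' : ℕ} :
      Exec c s n s' → Exec d s' n' s'' → Exec (Prog.seq c d) s (n + n') s''
  | ite_true {x : ℕ} {c d : Prog} {s s' : Store} {n : ℕ} :
      s x ≠ BinaryTree.nil → Exec c s n s' → Exec (Prog.ite x c d) s (n + 1) s'
  | ite_false {x : ℕ} {c d : Prog} {s s' : Store} {n : ℕ} :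
      s x = BinaryTree.nil → Exec d s n s' → Exec (Prog.ite x c d) s (n + 1) s'
  | loop_exit {x : ℕ} {c : Prog} {s : Store} :
      s x = BinaryTree.nil → Exec (Prog.loop x c) s 1 s
  | loop_step {x : ℕ} {c : Prog} {s s' s'' : Store} {n n' : ℕ} :
      s x ≠ BinaryTree.nil → Exec c s n s' → Exec (Prog.loop x c) s' n' s'' →
        Exec (Prog.loop x c) s (n + n' + 1) s''

/-- Programs are deterministic: the running time and the final store are determined by the program
and the initial store. -/
theorem Exec.deterministic {c : Prog} {s s₁ s₂ : Store} {n₁ n₂ : ℕ}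
    (h₁ : Exec c s n₁ s₁) (h₂ : Exec c s n₂ s₂) : n₁ = n₂ ∧ s₁ = s₂ := by
  induction h₁ generalizing n₂ s₂ with
  | nil | copy | cons | hd | tl => cases h₂; exact ⟨rfl, rfl⟩
  | seq _ _ ih₁ ih₂ =>
    cases h₂ with
    | seq a b =>
      obtain ⟨rfl, rfl⟩ := ih₁ a
      obtain ⟨rfl, rfl⟩ := ih₂ b
      exact ⟨rfl, rfl⟩
  | ite_true hx _ ih =>
    cases h₂ with
    | ite_true _ a => obtain ⟨rfl, rfl⟩ := ih a; exact ⟨rfl, rfl⟩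
    | ite_false hx' _ => exact absurd hx' hx
  | ite_false hx _ ih =>
    cases h₂ with
    | ite_true hx' _ => exact absurd hx hx'
    | ite_false _ a => obtain ⟨rfl, rfl⟩ := ih a; exact ⟨rfl, rfl⟩
  | loop_exit hx =>
    cases h₂ with
    | loop_exit _ => exact ⟨rfl, rfl⟩
    | loop_step hx' _ _ => exact absurd hx hx'
  | loop_step hx _ _ ih₁ ih₂ =>
    cases h₂ with
    | loop_exit hx' => exact absurd hx' hx
    | loop_step _ a b =>
      obtain ⟨rfl, rfl⟩ := ih₁ a
      obtain ⟨rfl, rfl⟩ := ih₂ b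
      exact ⟨rfl, rfl⟩

/-- The initial store: the input is in variable `0`, all other variables are empty. -/
def initStore (input : BinaryTree Unit) : Store :=
  Function.update (fun _ => BinaryTree.nil) 0 input

/-- Started on `input`, the program `c` halts after at most `T` elementary operations, with the
encoding of the truth value of `answer` in variable `0`. -/
def AnswersWithin (c : Prog) (input : BinaryTree Unit) (answer : Prop) (T : ℕ) : Prop :=
  ∃ (n : ℕ) (s : Store), Exec c (initStore input) n s ∧ n ≤ T ∧
    (answer → s 0 = encBool true) ∧ (¬ answer → s 0 = encBool false)

end BSM

/-!
Why Above-Min BSM can be decided in time `O*(8^t)`.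

A matching is described by a *pointer vector*, which gives for every man a position in his list. If
the pointers are lower bounds for a stable matching `μ` (`α ≤ vec μ`), they stay so when every man
who is rejected advances; here, a man pointing at `w` is rejected if somebody whom `w` prefers to
him has reached `w` (`advance_le_vec`). Starting from `0`, the rounds of proposals end in the
man-optimal matching (`isManOptimal_opt`), and for the exchanged roles in the woman-optimal one.

The decision is made by a search tree. A node consists of a pointer vector and a set of marked men,
and stands for the stable matchings `μ` above the pointers in which the marked men have the wives
they point at, these wives not getting their best stable partners (`Compatible`). After the rounds
of proposals, the node is examined as follows. If the pointers give a stable matching of balance at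
most `k`, the answer is yes. Otherwise take an unmarked man who points at a woman whose best stable
partner is someone else: in `μ` he either gets someone worse (advance his pointer) or exactly her
(mark him). If there is no such man, then the pointers are the only stable matching that the node
can stand for (`eq_vec_of_forall`). As all stable matchings match the same persons
(`points_iff_matched`), advancing a pointer costs the men at least one above `O_M`
(`sum_vec_add_OM`), and marking a man costs the women at least one above `O_W` (`sum_add_OW_le`). A
node at which the men would have to lose more than `k - O_M`, or the women more than `k - O_W`, is
discarded. Both of these budgets are at most `t`, so the tree has depth at most `2t + 2` and
`O(4^t)` nodes (`weight_child`, `weight_root_le`).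

For the running time on the machine, a class `PT` of polynomial-time functions between types
represented by trees is shown to be closed under composition, pairing, case distinction and folds
with an accumulator of polynomial size. The work at one node is an ordinary function on lists in
this class (`PT.visit`), and `exists_search` turns such a function into a program that searches the
tree with an explicit stack.
-/

namespace BSM

/-! ### Polynomial-time functions on encodable types -/

/-- Types whose elements are represented by trees. -/
class Enc (α : Type) where
  /-- The tree that represents an element. -/
  enc : α → BinaryTree Unit

open Enc

instance : Enc (BinaryTree Unit) := ⟨id⟩
/-- Natural numbers are represented in unary. -/
instance : Enc ℕ := ⟨encIndex⟩
instance : Enc Bool := ⟨encBool⟩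
instance : Enc Unit := ⟨fun _ => .nil⟩
instance {α β : Type} [Enc α] [Enc β] : Enc (α × β) := ⟨fun p => .node () (enc p.1) (enc p.2)⟩
instance {α : Type} [Enc α] : Enc (List α) := ⟨fun l => encList (l.map enc)⟩

/-- The number of nodes of the representation. -/
def size {α : Type} [Enc α] (a : α) : ℕ := (enc a).numNodes

section Size

variable {α β : Type} [Enc α] [Enc β]

theorem enc_pair (a : α) (b : β) : enc (a, b) = .node () (enc a) (enc b) := rfl

theorem enc_list_nil : enc ([] : List α) = .nil := rfl

theorem enc_cons (a : α) (l : List α) : enc (a :: l) = .node () (enc a) (enc l) := rfl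

theorem enc_zero : enc (0 : ℕ) = .nil := rfl

theorem enc_false : enc false = .nil := rfl

theorem enc_true : enc true = .node () .nil .nil := rfl

theorem enc_succ (n : ℕ) : enc (n + 1) = .node () .nil (enc n) := rfl

theorem enc_replicate (n : ℕ) : enc (List.replicate n ()) = enc n := by
  induction n with
  | zero => rfl
  | succ n ih => rw [List.replicate_succ, enc_cons, ih]; rfl

theorem size_pair (p : α × β) : size p = size p.1 + size p.2 + 1 := rfl

@[simp] theorem size_nil : size ([] : List α) = 0 := rfl

@[simp] theorem size_cons (a : α) (l : List α) : size (a :: l) = size a + size l + 1 := rfl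

@[simp] theorem size_nat (n : ℕ) : size n = n := by
  induction n with
  | zero => rfl
  | succ n ih =>
    have : size (n + 1) = 0 + size n + 1 := rfl
    omega

theorem size_bool_le (b : Bool) : size b ≤ 1 := by cases b <;> decide

@[simp] theorem size_append (l₁ l₂ : List α) : size (l₁ ++ l₂) = size l₁ + size l₂ := by
  induction l₁ with
  | nil => simp
  | cons a l ih => simp [ih]; omega

@[simp] theorem size_reverse (l : List α) : size l.reverse = size l := by
  induction l with
  | nil => simp
  | cons a l ih => simp [ih]; omega

theorem length_le_size (l : List α) : l.length ≤ size l := by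
  induction l with
  | nil => simp
  | cons a l ih => simp; omega

theorem size_le_of_mem {a : α} {l : List α} (h : a ∈ l) : size a ≤ size l := by
  induction l with
  | nil => simp at h
  | cons b l ih =>
    rcases List.mem_cons.1 h with rfl | h
    · simp; omega
    · have := ih h; simp; omega

theorem size_list_nat (l : List ℕ) : size l = l.sum + l.length := by
  induction l with
  | nil => simp
  | cons a l ih => simp [ih]; omega

end Size

theorem eval_mono (q : Polynomial ℕ) {a b : ℕ} (h : a ≤ b) : q.eval a ≤ q.eval b := by
  rw [Polynomial.eval_eq_sum, Polynomial.eval_eq_sum]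
  exact Finset.sum_le_sum fun i _ => Nat.mul_le_mul_left _ (Nat.pow_le_pow_left h i)

/-- Renumber the variables of a program, so that it leaves the first `d` variables alone. -/
def Prog.shift (d : ℕ) : Prog → Prog
  | .nil x => .nil (x + d)
  | .copy x y => .copy (x + d) (y + d)
  | .cons x y z => .cons (x + d) (y + d) (z + d)
  | .hd x y => .hd (x + d) (y + d)
  | .tl x y => .tl (x + d) (y + d)
  | .seq c e => .seq (c.shift d) (e.shift d)
  | .ite x c e => .ite (x + d) (c.shift d) (e.shift d)
  | .loop x c => .loop (x + d) (c.shift d)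

theorem update_shift {d : ℕ} {s S : Store} (h : ∀ i, S (i + d) = s i) (x : ℕ)
    (t : BinaryTree Unit) :
    (∀ i, Function.update S (x + d) t (i + d) = Function.update s x t i) ∧
      ∀ i < d, Function.update S (x + d) t i = S i := by
  constructor
  · intro i
    simp only [Function.update_apply, Nat.add_right_cancel_iff, h]
  · intro i hi
    rw [Function.update_of_ne]
    omega

theorem Exec.shift {c : Prog} {s s' : Store} {n : ℕ} (h : Exec c s n s') (d : ℕ) (S : Store)
    (hS : ∀ i, S (i + d) = s i) :
    ∃ S', Exec (c.shift d) S n S' ∧ (∀ i, S' (i + d) = s' i) ∧ ∀ i < d, S' i = S i := by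
  induction h generalizing S with
  | nil x s => exact ⟨_, Exec.nil _ _, update_shift hS _ _⟩
  | copy x y s =>
    have := update_shift hS x (s y)
    rw [← hS y] at this
    exact ⟨_, Exec.copy _ _ _, by rwa [← hS y]⟩
  | cons x y z s =>
    refine ⟨_, Exec.cons _ _ _ _, ?_⟩
    rw [hS y, hS z]
    exact update_shift hS _ _
  | hd x y s =>
    refine ⟨_, Exec.hd _ _ _, ?_⟩
    rw [hS y]
    exact update_shift hS _ _
  | tl x y s =>
    refine ⟨_, Exec.tl _ _ _, ?_⟩
    rw [hS y]
    exact update_shift hS _ _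
  | seq _ _ ih₁ ih₂ =>
    obtain ⟨S₁, e₁, h₁, k₁⟩ := ih₁ S hS
    obtain ⟨S₂, e₂, h₂, k₂⟩ := ih₂ S₁ h₁
    exact ⟨S₂, Exec.seq e₁ e₂, h₂, fun i hi => (k₂ i hi).trans (k₁ i hi)⟩
  | ite_true hx _ ih =>
    obtain ⟨S₁, e₁, h₁, k₁⟩ := ih S hS
    exact ⟨S₁, Exec.ite_true (by rwa [hS]) e₁, h₁, k₁⟩
  | ite_false hx _ ih =>
    obtain ⟨S₁, e₁, h₁, k₁⟩ := ih S hS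
    exact ⟨S₁, Exec.ite_false (by rwa [hS]) e₁, h₁, k₁⟩
  | loop_exit hx => exact ⟨S, Exec.loop_exit (by rwa [hS]), hS, fun _ _ => rfl⟩
  | loop_step hx _ _ ih₁ ih₂ =>
    obtain ⟨S₁, e₁, h₁, k₁⟩ := ih₁ S hS
    obtain ⟨S₂, e₂, h₂, k₂⟩ := ih₂ S₁ h₁
    exact ⟨S₂, Exec.loop_step (by rwa [hS]) e₁ e₂, h₂, fun i hi => (k₂ i hi).trans (k₁ i hi)⟩

/-- `f` is computed by a program in polynomial time, from variable `0` to variable `0`, whatever the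
other variables contain; moreover, the size of the value is polynomially bounded (which does not
follow from the time bound, as trees share subtrees in memory). -/
@[fun_prop]
def PT {α β : Type} [Enc α] [Enc β] (f : α → β) : Prop :=
  ∃ (c : Prog) (q : Polynomial ℕ), ∀ (a : α) (s : Store), s 0 = enc a →
    ∃ n s', Exec c s n s' ∧ s' 0 = enc (f a) ∧ n ≤ q.eval (size a) ∧ size (f a) ≤ q.eval (size a)

namespace PT

variable {α β γ δ : Type} [Enc α] [Enc β] [Enc γ] [Enc δ]

theorem of_bounds {f : α → β} (c : Prog) (q r : Polynomial ℕ)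
    (h : ∀ (a : α) (s : Store), s 0 = enc a →
      ∃ n s', Exec c s n s' ∧ s' 0 = enc (f a) ∧ n ≤ q.eval (size a))
    (hr : ∀ a, size (f a) ≤ r.eval (size a)) : PT f := by
  refine ⟨c, q + r, fun a s hs => ?_⟩
  obtain ⟨n, s', h₁, h₂, h₃⟩ := h a s hs
  have := hr a
  exact ⟨n, s', h₁, h₂, by simp; omega, by simp; omega⟩

theorem size_le {f : α → β} (hf : PT f) :
    ∃ q : Polynomial ℕ, ∀ a, size (f a) ≤ q.eval (size a) := by
  obtain ⟨c, q, h⟩ := hf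
  refine ⟨q, fun a => ?_⟩
  obtain ⟨_, _, _, _, _, h⟩ := h a (fun _ => enc a) rfl
  exact h

/-- A polynomial-time function can be called on variable `d`, the first `d` variables being
preserved. -/
theorem call {f : α → β} (hf : PT f) : ∃ (c : Prog) (q : Polynomial ℕ),
    ∀ (d : ℕ) (a : α) (s : Store), s d = enc a →
      ∃ n s', Exec (c.shift d) s n s' ∧ s' d = enc (f a) ∧ (∀ i < d, s' i = s i) ∧
        n ≤ q.eval (size a) := by
  obtain ⟨c, q, h⟩ := hf
  refine ⟨c, q, fun d a s hs => ?_⟩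
  obtain ⟨n, s', h₁, h₂, h₃, -⟩ := h a (fun i => s (i + d)) (by simpa using hs)
  obtain ⟨S', e, k, k'⟩ := h₁.shift d s fun _ => rfl
  exact ⟨n, S', e, by simpa [h₂] using k 0, k', h₃⟩

theorem of_enc_eq {f : α → β} (h : ∀ a, enc (f a) = enc a) : PT f :=
  of_bounds (.copy 0 0) 1 .X
    (fun a s hs => ⟨_, _, Exec.copy 0 0 s, by simp [hs, h], by simp⟩)
    (fun a => by simp [size, h])

@[fun_prop]
theorem id' : PT (fun a : α => a) := of_enc_eq fun _ => rfl

@[fun_prop]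
theorem comp {f : β → γ} {g : α → β} (hf : PT f) (hg : PT g) : PT (fun x => f (g x)) := by
  obtain ⟨c, q, h⟩ := hf
  obtain ⟨c', q', h'⟩ := hg
  refine ⟨c'.seq c, q' + q.comp q', fun a s hs => ?_⟩
  obtain ⟨n, s', e, hs', hn, hsz⟩ := h' a s hs
  obtain ⟨n₂, s₂, e₂, hs₂, hn₂, hsz₂⟩ := h _ s' hs'
  have := eval_mono q hsz
  exact ⟨_, _, e.seq e₂, hs₂, by simp; omega, by simp; omega⟩

@[fun_prop]
theorem pair {f : α → β} {g : α → γ} (hf : PT f) (hg : PT g) : PT (fun x => (f x, g x)) := by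
  obtain ⟨r, hr⟩ := hf.size_le
  obtain ⟨r', hr'⟩ := hg.size_le
  obtain ⟨c, q, h⟩ := hf.call
  obtain ⟨c', q', h'⟩ := hg.call
  refine of_bounds (.seq (.copy 2 0) (.seq (c.shift 2) (.seq (.copy 1 2) (.seq (.copy 2 0)
    (.seq (c'.shift 2) (.cons 0 1 2)))))) (q + q' + 4) (r + r' + 1) (fun a s hs => ?_) (fun a => ?_)
  · obtain ⟨n, s₁, e₁, k₁, p₁, b₁⟩ := h 2 a (Function.update s 2 (s 0)) (by simp [hs])
    obtain ⟨n₂, s₂, e₂, k₂, p₂, b₂⟩ := h' 2 a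
      (Function.update (Function.update s₁ 1 (s₁ 2)) 2 ((Function.update s₁ 1 (s₁ 2)) 0))
      (by simp [hs, p₁ 0])
    refine ⟨_, _, (Exec.copy 2 0 s).seq (e₁.seq ((Exec.copy 1 2 _).seq ((Exec.copy 2 0 _).seq
      (e₂.seq (Exec.cons 0 1 2 _))))), ?_, ?_⟩
    · simp [k₂, p₂ 1, k₁, enc_pair]
    · simp; omega
  · have := hr a
    have := hr' a
    simp [size_pair]; omega

@[fun_prop]
theorem fst : PT (fun p : α × β => p.1) :=
  of_bounds (.hd 0 0) 1 .X
    (fun a s hs => ⟨_, _, Exec.hd 0 0 s, by simp [hs, enc, fstTree], by simp⟩)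
    (fun a => by simp [size_pair]; omega)

@[fun_prop]
theorem snd : PT (fun p : α × β => p.2) :=
  of_bounds (.tl 0 0) 1 .X
    (fun a s hs => ⟨_, _, Exec.tl 0 0 s, by simp [hs, enc, sndTree], by simp⟩)
    (fun a => by simp [size_pair]; omega)

theorem const_of_enc_nil {b : β} (hb : enc b = .nil) : PT (fun _ : α => b) :=
  of_bounds (.nil 0) 1 0
    (fun a s _ => ⟨_, _, Exec.nil 0 s, by simp [hb], by simp⟩)
    (fun a => by simp [size, hb])

theorem const_tree (t : BinaryTree Unit) : PT (fun _ : α => t) := by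
  induction t with
  | nil => exact const_of_enc_nil rfl
  | node u a b iha ihb =>
    exact (of_enc_eq (f := fun p : BinaryTree Unit × BinaryTree Unit => BinaryTree.node () p.1 p.2)
      fun _ => rfl).comp (iha.pair ihb)

@[fun_prop]
theorem const (b : β) : PT (fun _ : α => b) := by
  obtain ⟨c, q, h⟩ := const_tree (α := α) (enc b)
  exact ⟨c, q, h⟩

@[fun_prop]
theorem cond {p : α → Bool} {f g : α → β} (hp : PT p) (hf : PT f) (hg : PT g) :
    PT (fun x => bif p x then f x else g x) := by
  obtain ⟨c, q, h⟩ := hp.call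
  obtain ⟨c₁, q₁, h₁⟩ := hf
  obtain ⟨c₂, q₂, h₂⟩ := hg
  refine ⟨.seq (.copy 1 0) (.seq (c.shift 1) (.ite 1 c₁ c₂)), q + q₁ + q₂ + 2, fun a s hs => ?_⟩
  obtain ⟨n, s₁, e₁, k₁, p₁, b₁⟩ := h 1 a (Function.update s 1 (s 0)) (by simp [hs])
  have h0 : s₁ 0 = enc a := by simp [p₁ 0, hs]
  cases hb : p a with
  | true =>
    obtain ⟨n₂, s₂, e₂, k₂, b₂, z₂⟩ := h₁ a s₁ h0
    refine ⟨_, _, (Exec.copy 1 0 s).seq (e₁.seq (Exec.ite_true ?_ e₂)),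
      by simpa [hb] using k₂, ?_, ?_⟩
    · simp [k₁, hb, enc_true]
    · simp; omega
    · simp [hb]; omega
  | false =>
    obtain ⟨n₂, s₂, e₂, k₂, b₂, z₂⟩ := h₂ a s₁ h0
    refine ⟨_, _, (Exec.copy 1 0 s).seq (e₁.seq (Exec.ite_false ?_ e₂)),
      by simpa [hb] using k₂, ?_, ?_⟩
    · simp [k₁, hb, enc_false]
    · simp; omega
    · simp [hb]; omega

@[fun_prop]
theorem and {p q : α → Bool} (hp : PT p) (hq : PT q) : PT (fun x => p x && q x) := by
  have : (fun x => p x && q x) = fun x => bif p x then q x else false := by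
    funext x; cases p x <;> rfl
  rw [this]; fun_prop

@[fun_prop]
theorem or {p q : α → Bool} (hp : PT p) (hq : PT q) : PT (fun x => p x || q x) := by
  have : (fun x => p x || q x) = fun x => bif p x then true else q x := by
    funext x; cases p x <;> rfl
  rw [this]; fun_prop

@[fun_prop]
theorem not {p : α → Bool} (hp : PT p) : PT (fun x => !p x) := by
  have : (fun x => !p x) = fun x => bif p x then false else true := by
    funext x; cases p x <;> rfl
  rw [this]; fun_prop

@[fun_prop]
theorem cons {f : α → β} {g : α → List β} (hf : PT f) (hg : PT g) : PT (fun x => f x :: g x) :=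
  (of_enc_eq (f := fun p : β × List β => p.1 :: p.2) fun _ => rfl).comp (hf.pair hg)

@[fun_prop]
theorem tail {f : α → List β} (hf : PT f) : PT (fun x => (f x).tail) := by
  refine comp (f := fun l : List β => l.tail) (of_bounds (.tl 0 0) 1 .X
    (fun a s hs => ⟨_, _, Exec.tl 0 0 s, ?_, by simp⟩) (fun a => ?_)) hf
  · cases a <;> simp [hs, enc_cons, enc_list_nil, sndTree]
  · cases a <;> simp; omega

theorem headD {f : α → List β} {d : β} (hd : enc d = .nil) (hf : PT f) :
    PT (fun x => (f x).headD d) := by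
  refine comp (f := fun l : List β => l.headD d) (of_bounds (.hd 0 0) 1 .X
    (fun a s hs => ⟨_, _, Exec.hd 0 0 s, ?_, by simp⟩) (fun a => ?_)) hf
  · cases a <;> simp [hs, enc_cons, enc_list_nil, fstTree, hd]
  · cases a <;> simp [size, hd]
    show _ ≤ size _
    rw [size_cons]; unfold size; omega

theorem isEmpty' : PT (fun l : List β => l.isEmpty) := by
  refine of_bounds (.ite 0 (.nil 0) (.cons 0 0 0)) 2 1 (fun a s hs => ?_)
    (fun a => by simpa using size_bool_le _)
  cases a with
  | nil =>
    refine ⟨_, _, Exec.ite_false (by rw [hs]; rfl) (Exec.cons 0 0 0 s), ?_, by simp⟩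
    simp [hs, enc_true, enc_list_nil]
  | cons b l =>
    exact ⟨_, _, Exec.ite_true (by simp [hs, enc_cons]) (Exec.nil 0 s), by simp [enc_false],
      by simp⟩

@[fun_prop]
theorem isEmpty {f : α → List β} (hf : PT f) : PT (fun x => (f x).isEmpty) := isEmpty'.comp hf

theorem replicate {f : α → ℕ} (hf : PT f) : PT (fun x => List.replicate (f x) ()) :=
  (of_enc_eq enc_replicate).comp hf

theorem succ {f : α → ℕ} (hf : PT f) : PT (fun x => f x + 1) :=
  comp (f := fun n : ℕ => n + 1) ((of_enc_eq (f := fun l : Unit × ℕ => l.2 + 1)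
    fun _ => rfl).comp ((const ()).pair id')) hf

theorem pred {f : α → ℕ} (hf : PT f) : PT (fun x => f x - 1) := by
  refine comp (f := fun n : ℕ => n - 1) (of_bounds (.tl 0 0) 1 .X
    (fun a s hs => ⟨_, _, Exec.tl 0 0 s, ?_, by simp⟩) (fun a => by simp)) hf
  cases a <;> simp [hs, enc_succ, enc_zero, sndTree]

/-- The body of the loop that computes a fold: variable `0` holds the context, `1` the rest of the
list, and `2` the accumulator. -/
def foldBody (c : Prog) : Prog :=
  .seq (.hd 3 1) (.seq (.tl 1 1) (.seq (.cons 4 2 3) (.seq (.cons 4 0 4)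
    (.seq (c.shift 4) (.copy 2 4)))))

theorem exec_foldBody {g : γ → β → α → β} {c : Prog} {q : Polynomial ℕ}
    (h : ∀ (d : ℕ) (a : γ × β × α) (s : Store), s d = enc a →
      ∃ n s', Exec (c.shift d) s n s' ∧ s' d = enc (g a.1 a.2.1 a.2.2) ∧ (∀ i < d, s' i = s i) ∧
        n ≤ q.eval (size a)) (x : γ) (M : ℕ) (l : List α) :
    ∀ (b : β) (s : Store), s 0 = enc x → s 1 = enc l → s 2 = enc b →
      (∀ l₁ a l₂, l = l₁ ++ a :: l₂ → q.eval (size (x, l₁.foldl (g x) b, a)) ≤ M) →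
      ∃ n s', Exec (.loop 1 (foldBody c)) s n s' ∧ s' 2 = enc (l.foldl (g x) b) ∧
        n ≤ l.length * (M + 6) + 1 := by
  induction l with
  | nil =>
    intro b s _ h1 h2 _
    exact ⟨1, s, Exec.loop_exit h1, h2, by simp⟩
  | cons a l ih =>
    intro b s h0 h1 h2 hM
    obtain ⟨n, s₁, e₁, k₁, p₁, b₁⟩ := h 4 (x, b, a)
      (Function.update (Function.update (Function.update (Function.update s 3 (enc a)) 1 (enc l))
        4 (.node () (enc b) (enc a))) 4 (enc (x, b, a))) (by simp)
    have E : Exec (foldBody c) s (1 + (1 + (1 + (1 + (n + 1))))) (Function.update s₁ 2 (s₁ 4)) := by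
      refine (Exec.hd 3 1 s).seq ((Exec.tl 1 1 _).seq ((Exec.cons 4 2 3 _).seq
        ((Exec.cons 4 0 4 _).seq (Exec.seq ?_ (Exec.copy 2 4 s₁)))))
      convert e₁ using 2 <;>
      simp [h0, h1, h2, enc_cons, fstTree, sndTree, enc_pair]
    obtain ⟨n₂, s₂, e₂, k₂, b₂⟩ := ih (g x b a) (Function.update s₁ 2 (s₁ 4))
      (by simp [p₁ 0, h0]) (by simp [p₁ 1]) (by simp [k₁])
      (fun l₁ a' l₂ hl => by simpa using hM (a :: l₁) a' l₂ (by simp [hl]))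
    refine ⟨_, _, Exec.loop_step (by simp [h1, enc_cons]) E e₂, k₂, ?_⟩
    have := hM [] a l rfl
    simp only [List.foldl_nil] at this
    rw [List.length_cons, Nat.succ_mul]
    omega

/-- Folds of polynomial-time functions are polynomial-time, if the accumulator stays of polynomial
size. -/
theorem foldl {l : γ → List α} {i : γ → β} {g : γ → β → α → β} (hl : PT l) (hi : PT i)
    (hg : PT (fun p : γ × β × α => g p.1 p.2.1 p.2.2))
    (hb : ∃ q : Polynomial ℕ, ∀ x l₁ l₂, l x = l₁ ++ l₂ →
      size (l₁.foldl (g x) (i x)) ≤ q.eval (size x)) :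
    PT (fun x => (l x).foldl (g x) (i x)) := by
  obtain ⟨r, hr⟩ := hl.size_le
  obtain ⟨qb, hb⟩ := hb
  obtain ⟨c, q, h⟩ := hl.call
  obtain ⟨c', q', h'⟩ := hi.call
  obtain ⟨cg, qg, hg⟩ := hg.call
  refine of_bounds (.seq (.copy 1 0) (.seq (c.shift 1) (.seq (.copy 2 0) (.seq (c'.shift 2)
    (.seq (.loop 1 (foldBody cg)) (.copy 0 2))))))
    (q + q' + r * (qg.comp (.X + qb + r + 2) + 6) + 4) qb (fun x s hs => ?_)
    (fun x => hb x (l x) [] (by simp))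
  obtain ⟨n₁, s₁, e₁, k₁, p₁, b₁⟩ := h 1 x (Function.update s 1 (s 0)) (by simp [hs])
  have h0 : s₁ 0 = enc x := by simp [p₁ 0, hs]
  obtain ⟨n₂, s₂, e₂, k₂, p₂, b₂⟩ := h' 2 x (Function.update s₁ 2 (s₁ 0)) (by simp [h0])
  obtain ⟨n₃, s₃, e₃, k₃, b₃⟩ := exec_foldBody hg x
    (qg.eval (size x + qb.eval (size x) + r.eval (size x) + 2)) (l x) (i x) s₂
    (by simp [p₂ 0, h0]) (by simp [p₂ 1, k₁]) k₂ (fun l₁ a l₂ hl => by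
      apply eval_mono
      have h₁ := hb x l₁ _ hl
      have h₂ : size a ≤ size (l x) := size_le_of_mem (by simp [hl])
      have h₃ := hr x
      simp only [size_pair]
      omega)
  refine ⟨_, _, (Exec.copy 1 0 s).seq (e₁.seq ((Exec.copy 2 0 _).seq (e₂.seq (e₃.seq
    (Exec.copy 0 2 _))))), by simp [k₃], ?_⟩
  have h₄ : (l x).length ≤ r.eval (size x) := (length_le_size _).trans (hr x)
  have := Nat.mul_le_mul_right
    (qg.eval (size x + qb.eval (size x) + r.eval (size x) + 2) + 6) h₄
  simp
  omega

/-- Folds of polynomial-time functions are polynomial-time, if each step makes the accumulator grow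
by a polynomial in the size of the context only. -/
theorem foldl_of_add {l : γ → List α} {i : γ → β} {g : γ → β → α → β} (hl : PT l) (hi : PT i)
    (hg : PT (fun p : γ × β × α => g p.1 p.2.1 p.2.2))
    (hb : ∃ q : Polynomial ℕ, ∀ x b, ∀ a ∈ l x, size (g x b a) ≤ size b + q.eval (size x)) :
    PT (fun x => (l x).foldl (g x) (i x)) := by
  obtain ⟨q, hb⟩ := hb
  obtain ⟨r, hr⟩ := hl.size_le
  obtain ⟨r', hr'⟩ := hi.size_le
  refine foldl hl hi hg ⟨r' + r * q, fun x l₁ l₂ h => ?_⟩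
  have key : ∀ (l₁ : List α) (b : β), (∀ a ∈ l₁, a ∈ l x) →
      size (l₁.foldl (g x) b) ≤ size b + l₁.length * q.eval (size x) := by
    intro l₁
    induction l₁ with
    | nil => simp
    | cons a l₁ ih =>
      intro b hb'
      have h₁ := ih (g x b a) fun a ha => hb' a (by simp [ha])
      have h₂ := hb x b a (hb' a (by simp))
      rw [List.foldl_cons, List.length_cons, Nat.succ_mul]
      omega
  have h₁ := key l₁ (i x) (by simp +contextual [h])
  have h₂ : l₁.length ≤ r.eval (size x) := by
    have h₃ := (length_le_size (l x)).trans (hr x)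
    rw [h, List.length_append] at h₃
    omega
  have := Nat.mul_le_mul_right (q.eval (size x)) h₂
  have := hr' x
  simp
  omega

/-! ### Arithmetic and lists -/

@[fun_prop]
theorem sub {f g : α → ℕ} (hf : PT f) (hg : PT g) : PT (fun x => f x - g x) := by
  have : (fun x => f x - g x) =
      fun x => (List.replicate (g x) ()).foldl (fun b _ => b - 1) (f x) := by
    funext x
    generalize f x = a
    generalize g x = b
    induction b generalizing a with
    | zero => simp
    | succ b ih => rw [List.replicate_succ, List.foldl_cons, ← ih]; omega
  rw [this]
  exact foldl_of_add (replicate hg) hf (pred (by fun_prop)) ⟨0, fun x b a _ => by simp⟩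

@[fun_prop]
theorem add {f g : α → ℕ} (hf : PT f) (hg : PT g) : PT (fun x => f x + g x) := by
  have : (fun x => f x + g x) =
      fun x => (List.replicate (g x) ()).foldl (fun b _ => b + 1) (f x) := by
    funext x
    generalize f x = a
    generalize g x = b
    induction b generalizing a with
    | zero => simp
    | succ b ih => rw [List.replicate_succ, List.foldl_cons, ← ih]; omega
  rw [this]
  exact foldl_of_add (replicate hg) hf (succ (by fun_prop)) ⟨1, fun x b a _ => by simp⟩

@[fun_prop]
theorem decide_le {f g : α → ℕ} (hf : PT f) (hg : PT g) : PT (fun x => decide (f x ≤ g x)) := by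
  have : (fun x => decide (f x ≤ g x)) = fun x => (List.replicate (f x - g x) ()).isEmpty := by
    funext x
    rw [Bool.eq_iff_iff]
    simp [Nat.sub_eq_zero_iff_le]
  rw [this]
  exact isEmpty (replicate (by fun_prop))

@[fun_prop]
theorem decide_lt {f g : α → ℕ} (hf : PT f) (hg : PT g) : PT (fun x => decide (f x < g x)) :=
  decide_le (f := fun x => f x + 1) (by fun_prop) hg

@[fun_prop]
theorem decide_eq {f g : α → ℕ} (hf : PT f) (hg : PT g) : PT (fun x => decide (f x = g x)) := by
  have : (fun x => decide (f x = g x)) = fun x => decide (f x ≤ g x) && decide (g x ≤ f x) := by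
    funext x
    rw [Bool.eq_iff_iff]
    simp
    omega
  rw [this]
  fun_prop

@[fun_prop]
theorem reverse {f : α → List β} (hf : PT f) : PT (fun x => (f x).reverse) := by
  have : (fun x => (f x).reverse) = fun x => (f x).foldl (fun b a => a :: b) [] := by
    funext x
    simp
  rw [this]
  obtain ⟨r, hr⟩ := hf.size_le
  refine foldl_of_add hf (const _) (by fun_prop) ⟨r + 1, fun x b a ha => ?_⟩
  have := size_le_of_mem ha
  have := hr x
  simp
  omega

@[fun_prop]
theorem map {l : γ → List α} {f : γ → α → β} (hl : PT l) (hf : PT (fun p : γ × α => f p.1 p.2)) :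
    PT (fun x => (l x).map fun a => f x a) := by
  have : (fun x => (l x).map (f x)) =
      fun x => ((l x).foldl (fun b a => f x a :: b) []).reverse := by
    funext x
    simp
  rw [this]
  obtain ⟨r, hr⟩ := hl.size_le
  obtain ⟨q, hq⟩ := hf.size_le
  refine reverse (foldl_of_add hl (const _) ?_ ⟨q.comp (.X + r + 1) + 1, fun x b a ha => ?_⟩)
  · exact cons (hf.comp (g := fun p : γ × List β × α => (p.1, p.2.2)) (by fun_prop)) (by fun_prop)
  · have h₁ := size_le_of_mem ha
    have h₂ := hr x
    have h₃ := hq (x, a)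
    have h₄ := eval_mono q (show size (x, a) ≤ size x + r.eval (size x) + 1 by
      rw [size_pair]; simp only; omega)
    simp at h₃ ⊢
    omega

@[fun_prop]
theorem any {l : γ → List α} {f : γ → α → Bool} (hl : PT l) (hf : PT (fun p : γ × α => f p.1 p.2)) :
    PT (fun x => (l x).any fun a => f x a) := by
  have : (fun x => (l x).any (f x)) = fun x => (l x).foldl (fun b a => b || f x a) false := by
    funext x
    have : ∀ (l : List α) (b : Bool), (b || l.any (f x)) = l.foldl (fun b a => b || f x a) b := by
      intro l
      induction l with
      | nil => simp
      | cons a l ih => intro b; simp [← ih, Bool.or_assoc]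
    simpa using this (l x) false
  rw [this]
  refine foldl hl (const _) (or (by fun_prop)
    (hf.comp (g := fun p : γ × Bool × α => (p.1, p.2.2)) (by fun_prop)))
    ⟨1, fun x l₁ l₂ _ => by simpa using size_bool_le _⟩

@[fun_prop]
theorem all {l : γ → List α} {f : γ → α → Bool} (hl : PT l) (hf : PT (fun p : γ × α => f p.1 p.2)) :
    PT (fun x => (l x).all fun a => f x a) := by
  have : (fun x => (l x).all (f x)) = fun x => !(l x).any (fun a => !f x a) := by
    funext x
    rw [List.not_any_eq_all_not]
    simp
  rw [this]
  exact not (any hl (not hf))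

@[fun_prop]
theorem filter {l : γ → List α} {f : γ → α → Bool} (hl : PT l)
    (hf : PT (fun p : γ × α => f p.1 p.2)) : PT (fun x => (l x).filter fun a => f x a) := by
  have : (fun x => (l x).filter (f x)) =
      fun x => ((l x).foldl (fun b a => bif f x a then a :: b else b) []).reverse := by
    funext x
    have : ∀ (l : List α) (b : List α), b.reverse ++ l.filter (f x) =
        (l.foldl (fun b a => bif f x a then a :: b else b) b).reverse := by
      intro l
      induction l with
      | nil => simp
      | cons a l ih => intro b; cases h : f x a <;> simp [h, ← ih]
    simpa using this (l x) []
  rw [this]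
  obtain ⟨r, hr⟩ := hl.size_le
  refine reverse (foldl_of_add hl (const _) (cond
    (hf.comp (g := fun p : γ × List α × α => (p.1, p.2.2)) (by fun_prop)) (by fun_prop)
    (by fun_prop)) ⟨r + 1, fun x b a ha => ?_⟩)
  have := size_le_of_mem ha
  have := hr x
  cases f x a <;> simp
  omega

@[fun_prop]
theorem length {l : γ → List α} (hl : PT l) : PT (fun x => (l x).length) := by
  have : (fun x => (l x).length) = fun x => (l x).foldl (fun b _ => b + 1) 0 := by
    funext x
    simp
  rw [this]
  exact foldl_of_add hl (const _) (by fun_prop) ⟨1, fun x b a _ => by simp⟩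

@[fun_prop]
theorem sum {l : γ → List ℕ} (hl : PT l) : PT (fun x => (l x).sum) := by
  have : (fun x => (l x).sum) = fun x => (l x).foldl (fun b a => b + a) 0 := by
    funext x
    exact List.sum_eq_foldl
  rw [this]
  obtain ⟨r, hr⟩ := hl.size_le
  refine foldl_of_add hl (const _) (by fun_prop) ⟨r, fun x b a ha => ?_⟩
  have := size_le_of_mem ha
  have := hr x
  simp at *
  omega

theorem getD {l : γ → List α} {n : γ → ℕ} {d : α} (hd : enc d = .nil) (hl : PT l) (hn : PT n) :
    PT (fun x => (l x).getD (n x) d) := by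
  have : (fun x => (l x).getD (n x) d) =
      fun x => ((List.replicate (n x) ()).foldl (fun l _ => l.tail) (l x)).headD d := by
    funext x
    generalize l x = a
    generalize n x = b
    induction b generalizing a with
    | zero => cases a <;> simp
    | succ b ih => rw [List.replicate_succ, List.foldl_cons, ← ih]; cases a <;> simp
  rw [this]
  refine headD hd (foldl_of_add (replicate hn) hl (by fun_prop) ⟨0, fun x b a _ => ?_⟩)
  cases b <;> simp; omega

@[fun_prop]
theorem getD_zero {l : γ → List ℕ} {n : γ → ℕ} (hl : PT l) (hn : PT n) :
    PT (fun x => (l x).getD (n x) 0) := getD rfl hl hn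

@[fun_prop]
theorem getD_nil {l : γ → List (List α)} {n : γ → ℕ} (hl : PT l) (hn : PT n) :
    PT (fun x => (l x).getD (n x) []) := getD rfl hl hn

@[fun_prop]
theorem range {n : γ → ℕ} (hn : PT n) : PT (fun x => List.range (n x)) := by
  have key : ∀ n, (List.replicate n ()).foldl (fun (b : ℕ × List ℕ) _ => (b.1 + 1, b.1 :: b.2))
      (0, []) = (n, (List.range n).reverse) := by
    intro n
    induction n with
    | zero => simp
    | succ n ih => rw [List.replicate_succ', List.foldl_append, ih]; simp [List.range_succ]
  have hr : ∀ n, size (List.range n) ≤ n * (n + 1) := by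
    intro n
    induction n with
    | zero => simp
    | succ n ih =>
      rw [List.range_succ, size_append]
      simp
      nlinarith
  have : (fun x => List.range (n x)) = fun x => ((List.replicate (n x) ()).foldl
      (fun (b : ℕ × List ℕ) _ => (b.1 + 1, b.1 :: b.2)) (0, [])).2.reverse := by
    funext x
    simp [key]
  rw [this]
  obtain ⟨r, hn'⟩ := hn.size_le
  refine reverse (snd.comp (foldl (replicate hn) (const _) (by fun_prop)
    ⟨r + r * (r + 1) + 1, fun x l₁ l₂ h => ?_⟩))
  have h₁ : l₁ = List.replicate l₁.length () := List.eq_replicate_length.2 fun _ _ => rfl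
  have h₂ : l₁.length ≤ r.eval (size x) := by
    have := congrArg List.length h
    have := hn' x
    simp at *
    omega
  rw [h₁, key, size_pair]
  have := hr l₁.length
  have := Nat.mul_le_mul h₂ (Nat.succ_le_succ h₂)
  simp at *
  omega

@[fun_prop]
theorem idxOf {l : γ → List ℕ} {n : γ → ℕ} (hl : PT l) (hn : PT n) :
    PT (fun x => (l x).idxOf (n x)) := by
  have key : ∀ (a : ℕ) (l : List ℕ) (k : ℕ),
      (l.foldl (fun (s : Bool × ℕ) y => bif s.1 then s else bif decide (y = a) then (true, s.2)
        else (false, s.2 + 1)) (true, k)).2 = k ∧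
      (l.foldl (fun (s : Bool × ℕ) y => bif s.1 then s else bif decide (y = a) then (true, s.2)
        else (false, s.2 + 1)) (false, k)).2 = l.idxOf a + k := by
    intro a l
    induction l with
    | nil => simp
    | cons b l ih =>
      intro k
      refine ⟨by simpa using (ih k).1, ?_⟩
      by_cases h : b = a
      · simpa [h] using (ih k).1
      · simpa [h, List.idxOf_cons_ne, add_assoc, add_comm 1 k] using (ih (k + 1)).2
  have : (fun x => (l x).idxOf (n x)) = fun x => ((l x).foldl (fun (s : Bool × ℕ) y =>
      bif s.1 then s else bif decide (y = n x) then (true, s.2) else (false, s.2 + 1))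
      (false, 0)).2 := by
    funext x
    simp [(key (n x) (l x) 0).2]
  rw [this]
  refine snd.comp (foldl_of_add hl (const _) ?_ ⟨2, fun x b a ha => ?_⟩)
  · have := hn.comp (g := fun p : γ × (Bool × ℕ) × ℕ => p.1) (by fun_prop)
    fun_prop
  · have h₁ := size_bool_le
    have := h₁ true
    have := h₁ false
    cases hb : b.1 <;> by_cases ha : a = n x <;> simp [size_pair, ha] <;> omega

end PT

/-! ### The algorithm, as functions on lists -/

section Algorithm

variable (mp wp : List (List ℕ))

/-- Some man who has reached `w` (his pointer is at `w` or later) is preferred by `w` to `m`. -/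
def better (a : List ℕ) (m w : ℕ) : Bool :=
  (List.range mp.length).any fun m' =>
    decide ((mp.getD m' []).idxOf w ≤ a.getD m' 0) &&
      decide ((wp.getD w []).idxOf m' < (wp.getD w []).idxOf m)

/-- The first `n` entries of `v`, increased by one at the indices satisfying `p`. -/
def bump (n : ℕ) (p : ℕ → Bool) (v : List ℕ) : List ℕ :=
  (List.range n).map fun i => bif p i then v.getD i 0 + 1 else v.getD i 0

/-- The man `m` is pointing at a woman of his list (and not past its end). -/
def pointing (a : List ℕ) (m : ℕ) : Bool :=
  decide (a.getD m 0 < (mp.getD m []).length)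

/-- The woman the man `m` is pointing at. -/
def target (a : List ℕ) (m : ℕ) : ℕ := (mp.getD m []).getD (a.getD m 0) 0

/-- One parallel round of proposals: every man who is rejected by the woman he is pointing at
advances his pointer. -/
def round (a : List ℕ) : List ℕ :=
  bump mp.length (fun m => pointing mp a m && better mp wp a m (target mp a m)) a

/-- The total length of the lists. -/
def total : ℕ := (mp.map fun l => l.length).sum

/-- Rounds of proposals, until no pointer moves any more. -/
def propose (a : List ℕ) : List ℕ :=
  (List.range (total mp)).foldl (fun a _ => round mp wp a) a

/-- Every woman who has been passed by a man has been reached by someone she prefers to him. -/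
def justified (a : List ℕ) : Bool :=
  (List.range mp.length).all fun m =>
    (List.range (a.getD m 0)).all fun i => better mp wp a m ((mp.getD m []).getD i 0)

/-- The dissatisfaction of the pointing side with the persons pointed at. -/
def ownCost (a : List ℕ) : ℕ :=
  ((List.range mp.length).map fun m => bif pointing mp a m then a.getD m 0 + 1 else 0).sum

/-- The dissatisfaction of the persons pointed at. -/
def otherCost (a : List ℕ) : ℕ :=
  ((List.range mp.length).map fun m =>
    bif pointing mp a m then (wp.getD (target mp a m) []).idxOf m + 1 else 0).sum

/-- The pointers give a stable matching of balance at most `K`. -/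
def good (K : ℕ) (a : List ℕ) : Bool :=
  justified mp wp a && (decide (ownCost mp a ≤ K) && decide (otherCost mp wp a ≤ K))

/-- The men on whom the search can branch: they are not marked in `F`, and they point at a woman
whose partner in the woman-optimal matching (given by `u`) is someone else. -/
def candidates (u a F : List ℕ) : List ℕ :=
  (List.range mp.length).filter fun m =>
    pointing mp a m && (decide (F.getD m 0 = 0) &&
      !decide (u.getD (target mp a m) 0 = (wp.getD (target mp a m) []).idxOf m))

/-- The children of a node of the search tree: the first candidate either gets someone worse, or
is marked. -/
def branch (n : ℕ) (c a F : List ℕ) : List (List ℕ × List ℕ) :=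
  bif c.isEmpty then [] else
    [(bump n (fun i => decide (i = c.headD 0)) a, F),
      (a, bump n (fun i => decide (i = c.headD 0)) F)]

/-- Examine a node of the search tree whose pointers do not move any more: report success, or give
the children, unless one of the two budgets is exceeded. -/
def expand (a₀ u : List ℕ) (K : ℕ) (a F : List ℕ) : Bool × List (List ℕ × List ℕ) :=
  bif decide (a.sum + ownCost mp a₀ ≤ K + a₀.sum) && decide (F.sum + ownCost wp u ≤ K) then
    bif good mp wp K a then (true, [])
    else (false, branch mp.length (candidates mp wp u a F) a F)
  else (false, [])

/-- Examine a node of the search tree. -/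
def visit (x : List (List ℕ) × List (List ℕ) × List ℕ × List ℕ × ℕ) (p : List ℕ × List ℕ) :
    Bool × List (List ℕ × List ℕ) :=
  expand x.1 x.2.1 x.2.2.1 x.2.2.2.1 x.2.2.2.2 (propose x.1 x.2.1 p.1) p.2

/-- The vector with `n` entries `0`. -/
def zeros (n : ℕ) : List ℕ := (List.range n).map fun _ => 0

/-- The number with binary digits `bits` (least significant first), or `c` if it is larger. The cap
keeps the unary representation of the result small; no stable matching costs more than the total
length of the lists, so capping `k` there does not change the answer. -/
def capBits (c : ℕ) (bits : List Bool) : ℕ :=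
  bits.reverse.foldl (fun r b =>
    bif decide (r + r + (bif b then 1 else 0) ≤ c) then r + r + (bif b then 1 else 0) else c) 0

/-- The data that the search needs, and the list consisting of the root of the search tree. -/
def start (x : List Bool × List (List ℕ) × List (List ℕ) × Unit) :
    (List (List ℕ) × List (List ℕ) × List ℕ × List ℕ × ℕ) × List (List ℕ × List ℕ) :=
  ((x.2.1, x.2.2.1, propose x.2.1 x.2.2.1 (zeros x.2.1.length),
    propose x.2.2.1 x.2.1 (zeros x.2.2.1.length), capBits (total x.2.1 + total x.2.2.1) x.1),
    [(propose x.2.1 x.2.2.1 (zeros x.2.1.length), zeros x.2.1.length)])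

end Algorithm

theorem size_bump_le (n : ℕ) (p : ℕ → Bool) (v : List ℕ) :
    size (bump n p v) ≤ size v + 2 * n := by
  have h : ∀ n (v : List ℕ), ((List.range n).map fun i => v.getD i 0).sum ≤ v.sum := by
    intro n
    induction n with
    | zero => simp
    | succ n ih =>
      intro v
      cases v with
      | nil => simp
      | cons b v =>
        have := ih v
        simpa [List.range_succ_eq_map, Function.comp_def] using this
  have h' : (bump n p v).sum ≤ ((List.range n).map fun i => v.getD i 0).sum + n := by
    unfold bump
    induction n with
    | zero => simp
    | succ n ih =>
      simp only [List.range_succ, List.map_append, List.sum_append, List.map_cons, List.map_nil,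
        List.sum_cons, List.sum_nil]
      cases p n <;> simp only [cond_true, cond_false] <;> omega
  have := h n v
  have : (bump n p v).length = n := by simp [bump]
  rw [size_list_nat, size_list_nat]
  omega

/-! ### The algorithm runs in polynomial time at each node -/

namespace PT

variable {γ : Type} [Enc γ] {mp wp : γ → List (List ℕ)} {a u F : γ → List ℕ} {m w n : γ → ℕ}

@[fun_prop]
theorem better (hmp : PT mp) (hwp : PT wp) (ha : PT a) (hm : PT m) (hw : PT w) :
    PT (fun x => better (mp x) (wp x) (a x) (m x) (w x)) := by
  unfold BSM.better
  fun_prop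

@[fun_prop]
theorem bump {p : γ → ℕ → Bool} (hn : PT n) (hp : PT (fun y : γ × ℕ => p y.1 y.2)) (ha : PT a) :
    PT (fun x => bump (n x) (fun i => p x i) (a x)) := by
  unfold BSM.bump
  fun_prop

@[fun_prop]
theorem pointing (hmp : PT mp) (ha : PT a) (hm : PT m) :
    PT (fun x => pointing (mp x) (a x) (m x)) := by
  unfold BSM.pointing
  fun_prop

@[fun_prop]
theorem target (hmp : PT mp) (ha : PT a) (hm : PT m) :
    PT (fun x => target (mp x) (a x) (m x)) := by
  unfold BSM.target
  fun_prop

@[fun_prop]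
theorem round (hmp : PT mp) (hwp : PT wp) (ha : PT a) :
    PT (fun x => round (mp x) (wp x) (a x)) := by
  unfold BSM.round
  fun_prop

@[fun_prop]
theorem total (hmp : PT mp) : PT (fun x => total (mp x)) := by
  unfold BSM.total
  fun_prop

@[fun_prop]
theorem propose (hmp : PT mp) (hwp : PT wp) (ha : PT a) :
    PT (fun x => propose (mp x) (wp x) (a x)) := by
  unfold BSM.propose
  obtain ⟨q, hq⟩ := hmp.size_le
  refine foldl_of_add (by fun_prop) ha (by fun_prop) ⟨2 * q, fun x b _ _ => ?_⟩
  have h₁ := size_bump_le (mp x).length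
    (fun m => BSM.pointing (mp x) b m && BSM.better (mp x) (wp x) b m (BSM.target (mp x) b m)) b
  have h₂ := (length_le_size (mp x)).trans (hq x)
  simp only [Polynomial.eval_mul, Polynomial.eval_ofNat, BSM.round]
  omega

@[fun_prop]
theorem justified (hmp : PT mp) (hwp : PT wp) (ha : PT a) :
    PT (fun x => justified (mp x) (wp x) (a x)) := by
  unfold BSM.justified
  fun_prop

@[fun_prop]
theorem ownCost (hmp : PT mp) (ha : PT a) : PT (fun x => ownCost (mp x) (a x)) := by
  unfold BSM.ownCost
  fun_prop

@[fun_prop]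
theorem otherCost (hmp : PT mp) (hwp : PT wp) (ha : PT a) :
    PT (fun x => otherCost (mp x) (wp x) (a x)) := by
  unfold BSM.otherCost
  fun_prop

@[fun_prop]
theorem good (hmp : PT mp) (hwp : PT wp) (hn : PT n) (ha : PT a) :
    PT (fun x => good (mp x) (wp x) (n x) (a x)) := by
  unfold BSM.good
  fun_prop

@[fun_prop]
theorem candidates (hmp : PT mp) (hwp : PT wp) (hu : PT u) (ha : PT a) (hF : PT F) :
    PT (fun x => candidates (mp x) (wp x) (u x) (a x) (F x)) := by
  unfold BSM.candidates
  fun_prop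

@[fun_prop]
theorem branch {c : γ → List ℕ} (hn : PT n) (hc : PT c) (ha : PT a) (hF : PT F) :
    PT (fun x => branch (n x) (c x) (a x) (F x)) := by
  unfold BSM.branch
  have hh : PT (fun x => (c x).headD 0) := headD rfl hc
  have hh' : PT (fun y : γ × ℕ => decide (y.2 = (c y.1).headD 0)) :=
    decide_eq snd (hh.comp fst)
  have h₁ : PT (fun x => BSM.bump (n x) (fun i => decide (i = (c x).headD 0)) (a x)) :=
    bump hn hh' ha
  have h₂ : PT (fun x => BSM.bump (n x) (fun i => decide (i = (c x).headD 0)) (F x)) :=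
    bump hn hh' hF
  fun_prop

@[fun_prop]
theorem expand {a₀ : γ → List ℕ} (hmp : PT mp) (hwp : PT wp) (ha₀ : PT a₀) (hu : PT u) (hn : PT n)
    (ha : PT a) (hF : PT F) :
    PT (fun x => expand (mp x) (wp x) (a₀ x) (u x) (n x) (a x) (F x)) := by
  unfold BSM.expand
  fun_prop

theorem visit : PT (fun y : (List (List ℕ) × List (List ℕ) × List ℕ × List ℕ × ℕ) ×
    (List ℕ × List ℕ) => visit y.1 y.2) := by
  unfold BSM.visit
  fun_prop

@[fun_prop]
theorem capBits {b : γ → List Bool} (hn : PT n) (hb : PT b) :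
    PT (fun x => capBits (n x) (b x)) := by
  unfold BSM.capBits
  obtain ⟨q, hq⟩ := hn.size_le
  refine foldl (by fun_prop) (const _) (by fun_prop) ⟨q, fun x l₁ l₂ _ => le_trans ?_ (hq x)⟩
  rw [size_nat, size_nat]
  induction l₁ using List.reverseRecOn with
  | nil => simp
  | append_singleton l b ih =>
    rw [List.foldl_append, List.foldl_cons, List.foldl_nil]
    generalize List.foldl _ 0 l = r
    by_cases h : r + r + (bif b then 1 else 0) ≤ n x <;> simp [h]

@[fun_prop]
theorem zeros (hn : PT n) : PT (fun x => zeros (n x)) := by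
  unfold BSM.zeros
  fun_prop

theorem start : PT start := by
  unfold BSM.start
  fun_prop

end PT

/-! ### Depth-first search with an explicit stack -/

/-- Move the first element of the list in variable `4`, if any, to the stack in variable `1`. -/
def pushOne : Prog :=
  .ite 4 (.seq (.hd 5 4) (.seq (.cons 1 5 1) (.tl 4 4))) (.copy 4 4)

theorem exec_pushOne {N : Type} [Enc N] (ch S : List N) (s : Store) (h4 : s 4 = enc ch)
    (h1 : s 1 = enc S) :
    ∃ s' n, Exec pushOne s n s' ∧ n ≤ 4 ∧ s' 4 = enc ch.tail ∧ s' 1 = enc (ch.head?.toList ++ S) ∧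
      s' 0 = s 0 ∧ s' 2 = s 2 := by
  cases ch with
  | nil =>
    exact ⟨_, _, Exec.ite_false h4 (Exec.copy 4 4 s), by norm_num, by simp [h4], by simp [h1],
      by simp, by simp⟩
  | cons p ch =>
    refine ⟨_, _, Exec.ite_true (by simp [h4, enc_cons]) ((Exec.hd 5 4 s).seq
      ((Exec.cons 1 5 1 _).seq (Exec.tl 4 4 _))), by norm_num, ?_, ?_, ?_, ?_⟩ <;>
    simp [h4, h1, enc_cons, fstTree, sndTree]

/-- The body of the search loop: variable `0` holds the context, `1` the stack, and `2` the answer;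
`c` examines a node. -/
def searchBody (c : Prog) : Prog :=
  .seq (.hd 4 1) (.seq (.tl 1 1) (.seq (.cons 4 0 4) (.seq (c.shift 4) (.seq (.hd 3 4)
    (.seq (.tl 4 4) (.ite 3 (.seq (.nil 1) (.cons 2 1 1)) (.seq pushOne pushOne)))))))

/-- A polynomial-time function `step`, which examines a node of a search tree and returns a flag for
success and at most two children, gives rise to a program for searching the whole tree. The time is
proportional to a weight `wt` bounding the number of nodes below a given one. The search reports
success only if `Ans` holds, provided that no node reports success otherwise; and it does report
success when one of the nodes it starts from satisfies `Sol`, provided that a node which satisfies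
`Sol` and does not report success has a child which satisfies `Sol`. -/
theorem exists_search {X N : Type} [Enc X] [Enc N] {step : X → N → Bool × List N}
    (hstep : PT (fun y : X × N => step y.1 y.2)) :
    ∃ (c : Prog) (q : Polynomial ℕ), ∀ (x : X) (valid Sol : N → Prop) (Ans : Prop) (wt : N → ℕ)
      (B : ℕ), (∀ p, valid p → size p ≤ B) →
      (∀ p, valid p → ∀ p' ∈ (step x p).2, valid p') →
      (∀ p, (step x p).2.length ≤ 2) →
      (∀ p, valid p → ((step x p).2.map wt).sum + 1 ≤ wt p) →
      (∀ p, valid p → (step x p).1 = true → Ans) →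
      (∀ p, valid p → Sol p → (step x p).1 = false → ∃ p' ∈ (step x p).2, Sol p') →
      ∀ (S : List N) (s : Store), (∀ p ∈ S, valid p) →
        s 0 = enc x → s 1 = enc S → s 2 = enc false →
        ∃ (n : ℕ) (s' : Store) (b : Bool), Exec c s n s' ∧ s' 2 = enc b ∧ (b = true → Ans) ∧
          ((∃ p ∈ S, Sol p) → b = true) ∧
          n ≤ (S.map wt).sum * q.eval (size x + B) + 1 := by
  obtain ⟨c, q, h⟩ := hstep.call
  refine ⟨.loop 1 (searchBody c), q.comp (.X + 1) + 17, ?_⟩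
  intro x valid Sol Ans wt B hB hvalid hlen hwt hsound hcompl S
  generalize hW : (S.map wt).sum = W
  induction W using Nat.strong_induction_on generalizing S with
  | _ W ih =>
    intro s hS h0 h1 h2
    cases S with
    | nil => exact ⟨1, s, false, Exec.loop_exit h1, h2, by simp, by simp, by simp⟩
    | cons p S =>
      have hp := hS p (by simp)
      have hwp := hwt p hp
      simp only [List.map_cons, List.sum_cons] at hW
      obtain ⟨n, s₁, e₁, k₁, p₁, b₁⟩ := h 4 (x, p)
        (Function.update (Function.update (Function.update s 4 (enc p)) 1 (enc S)) 4 (enc (x, p)))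
        (by simp)
      have hn : n ≤ q.eval (size x + B + 1) := b₁.trans (eval_mono q (by
        have := hB p hp
        simp only [size_pair]
        omega))
      set M := q.eval (size x + B + 1) with hM
      have hM' : (q.comp (Polynomial.X + 1) + 17).eval (size x + B) = M + 17 := by simp [hM]
      rw [hM']
      have pre : ∀ n' s', Exec (.ite 3 (.seq (.nil 1) (.cons 2 1 1)) (.seq pushOne pushOne))
          (Function.update (Function.update s₁ 3 (enc (step x p).1)) 4 (enc (step x p).2)) n' s' →
          Exec (searchBody c) s (1 + (1 + (1 + (n + (1 + (1 + n')))))) s' := by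
        intro n' s' e'
        refine (Exec.hd 4 1 s).seq ((Exec.tl 1 1 _).seq ((Exec.cons 4 0 4 _).seq (Exec.seq ?_
          ((Exec.hd 3 4 s₁).seq ((Exec.tl 4 4 _).seq ?_)))))
        · convert e₁ using 2 <;>
          simp [h0, h1, enc_cons, fstTree, sndTree, enc_pair]
        · convert e' using 2 <;>
          simp [k₁, enc, fstTree, sndTree]
      have hne : s 1 ≠ .nil := by simp [h1, enc_cons]
      cases hf : (step x p).1 with
      | true =>
        rw [hf] at pre
        refine ⟨_, _, true, Exec.loop_step hne (pre _ _ (Exec.ite_true (by simp [enc_true])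
          ((Exec.nil 1 _).seq (Exec.cons 2 1 1 _)))) (Exec.loop_exit (by simp)), by simp [enc_true],
          fun _ => hsound p hp hf, fun _ => rfl, ?_⟩
        have : 1 * (M + 17) ≤ W * (M + 17) := Nat.mul_le_mul_right _ (by omega)
        omega
      | false =>
        rw [hf] at pre
        obtain ⟨s₂, n₂, e₂, b₂, k₂4, k₂1, k₂0, k₂2⟩ := exec_pushOne (step x p).2 S
          (Function.update (Function.update s₁ 3 (enc false)) 4 (enc (step x p).2)) (by simp)
          (by simp [p₁ 1])
        obtain ⟨s₃, n₃, e₃, b₃, k₃4, k₃1, k₃0, k₃2⟩ := exec_pushOne _ _ s₂ k₂4 k₂1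
        obtain ⟨S', hS', hmem, hsum⟩ : ∃ S', S' = (step x p).2.tail.head?.toList ++
            ((step x p).2.head?.toList ++ S) ∧ (∀ p', p' ∈ S' ↔ p' ∈ (step x p).2 ∨ p' ∈ S) ∧
            (S'.map wt).sum = ((step x p).2.map wt).sum + (S.map wt).sum := by
          refine ⟨_, rfl, ?_⟩
          have hl := hlen p
          generalize (step x p).2 = ch at hl ⊢
          match ch, hl with
          | [], _ => simp
          | [a], _ => simp
          | [a, b], _ =>
            refine ⟨fun p' => ?_, ?_⟩
            · simp
              tauto
            · simp
              omega
          | _ :: _ :: _ :: _, hl => simp at hl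
        rw [← hS'] at k₃1
        obtain ⟨n₄, s₄, b, e₄, k₄, hb, hb', b₄⟩ := ih _ (by omega) S' rfl s₃
          (fun p' hp' => ((hmem p').1 hp').elim (hvalid p hp p') fun h => hS p' (by simp [h]))
          (by rw [k₃0, k₂0]; simp [p₁ 0, h0]) k₃1 (by rw [k₃2, k₂2]; simp [p₁ 2, h2])
        refine ⟨_, s₄, b, Exec.loop_step hne (pre _ _ (Exec.ite_false (by simp [enc_false])
          (e₂.seq e₃))) e₄, k₄, hb, ?_, ?_⟩
        · rintro ⟨p', hp', hsol⟩
          rcases List.mem_cons.1 hp' with rfl | hp'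
          · obtain ⟨p'', h₁, h₂⟩ := hcompl p' hp hsol hf
            exact hb' ⟨p'', (hmem _).2 (.inl h₁), h₂⟩
          · exact hb' ⟨p', (hmem _).2 (.inr hp'), hsol⟩
        · have : ((S'.map wt).sum + 1) * (M + 17) ≤ W * (M + 17) :=
            Nat.mul_le_mul_right _ (by omega)
          rw [hM'] at b₄
          rw [Nat.succ_mul] at this
          omega

/-! ### Pointer vectors and stable matchings -/

namespace Instance

variable (I : Instance)

/-- The instance with the roles of men and women exchanged. -/
abbrev swap : Instance where
  men := I.women
  women := I.men
  menPref := I.womenPref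
  womenPref := I.menPref
  menPref_nodup := I.womenPref_nodup
  womenPref_nodup := I.menPref_nodup
  mem_iff := fun m w => (I.mem_iff w m).symm

variable {I}
variable {α β : Fin I.men → ℕ} {μ ν : Finset (Fin I.men × Fin I.women)}

variable (I) in
/-- In the pointer vector `α`, the man `m` is pointing at position `α m` (starting from `0`) of his
list, where `w` is to be found. A pointer equal to the length of the list points at nobody. -/
def Points (α : Fin I.men → ℕ) (m : Fin I.men) (w : Fin I.women) : Prop :=
  w ∈ I.menPref m ∧ (I.menPref m).idxOf w = α m

variable (I) in
/-- Some man who has reached `w` is preferred by `w` to `m`. -/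
def Better (α : Fin I.men → ℕ) (m : Fin I.men) (w : Fin I.women) : Prop :=
  ∃ m', (I.menPref m').idxOf w ≤ α m' ∧ (I.womenPref w).idxOf m' < (I.womenPref w).idxOf m

variable (I) in
open Classical in
/-- One parallel round of proposals: every rejected man advances his pointer. -/
noncomputable def advance (α : Fin I.men → ℕ) : Fin I.men → ℕ := fun m =>
  if ∃ w, I.Points α m w ∧ I.Better α m w then α m + 1 else α m

variable (I) in
/-- No man is rejected. -/
def Stationary (α : Fin I.men → ℕ) : Prop := ∀ m w, I.Points α m w → ¬ I.Better α m w

variable (I) in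
/-- Every woman who has been passed by a man has been reached by someone she prefers to him. -/
def Justified (α : Fin I.men → ℕ) : Prop :=
  ∀ m w, w ∈ I.menPref m → (I.menPref m).idxOf w < α m → I.Better α m w

variable (I) in
open Classical in
/-- The pairs given by a pointer vector. -/
noncomputable def pairs (α : Fin I.men → ℕ) : Finset (Fin I.men × Fin I.women) :=
  Finset.univ.filter fun e => I.Points α e.1 e.2

variable (I) in
open Classical in
/-- The pointer vector of a matching. -/
noncomputable def vec (μ : Finset (Fin I.men × Fin I.women)) : Fin I.men → ℕ := fun m =>
  if h : ∃ w, (m, w) ∈ μ then (I.menPref m).idxOf h.choose else (I.menPref m).length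

@[simp] theorem mem_pairs {m : Fin I.men} {w : Fin I.women} :
    (m, w) ∈ I.pairs α ↔ I.Points α m w := by simp [pairs]

theorem Points.lt {m : Fin I.men} {w : Fin I.women} (h : I.Points α m w) :
    α m < (I.menPref m).length := h.2 ▸ List.idxOf_lt_length_iff.2 h.1

theorem points_iff {m : Fin I.men} {w : Fin I.women} :
    I.Points α m w ↔ ∃ h : α m < (I.menPref m).length, (I.menPref m)[α m] = w := by
  constructor
  · rintro ⟨h₁, h₂⟩
    refine ⟨h₂ ▸ List.idxOf_lt_length_iff.2 h₁, ?_⟩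
    simp [← h₂]
  · rintro ⟨h, rfl⟩
    exact ⟨List.getElem_mem h, (I.menPref_nodup m).idxOf_getElem _ h⟩

theorem exists_points_iff {m : Fin I.men} :
    (∃ w, I.Points α m w) ↔ α m < (I.menPref m).length := by
  simp [points_iff]

theorem Points.unique {m : Fin I.men} {w w' : Fin I.women} (h : I.Points α m w)
    (h' : I.Points α m w') : w = w' := (List.idxOf_inj h.1).1 (h.2.trans h'.2.symm)

theorem vec_of_mem (hμ : I.IsMatching μ) {m : Fin I.men} {w : Fin I.women} (h : (m, w) ∈ μ) :
    I.vec μ m = (I.menPref m).idxOf w := by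
  have h' : ∃ w, (m, w) ∈ μ := ⟨w, h⟩
  rw [vec, dif_pos h', hμ.woman_unique _ _ _ h'.choose_spec h]

theorem vec_of_not_mem {m : Fin I.men} (h : ∀ w, (m, w) ∉ μ) :
    I.vec μ m = (I.menPref m).length := dif_neg (by simpa using h)

theorem vec_le (m : Fin I.men) : I.vec μ m ≤ (I.menPref m).length := by
  unfold vec
  split
  · exact List.idxOf_le_length
  · exact le_rfl

theorem points_vec (hμ : I.IsMatching μ) {m : Fin I.men} {w : Fin I.women} :
    I.Points (I.vec μ) m w ↔ (m, w) ∈ μ := by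
  constructor
  · intro h
    by_cases h' : ∃ w, (m, w) ∈ μ
    · obtain ⟨w', hw'⟩ := h'
      have := vec_of_mem hμ hw'
      rwa [← (List.idxOf_inj h.1).1 (h.2.trans this)] at hw'
    · have := vec_of_not_mem (by simpa using h')
      have := h.lt
      omega
  · intro h
    exact ⟨(hμ.acceptable _ _ h).1, (vec_of_mem hμ h).symm⟩

theorem pairs_vec (hμ : I.IsMatching μ) : I.pairs (I.vec μ) = μ := by
  ext ⟨m, w⟩
  rw [mem_pairs, points_vec hμ]

theorem le_advance : α ≤ I.advance α := by
  intro m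
  unfold advance
  split
  · exact Nat.le_succ _
  · exact le_rfl

theorem advance_le (hα : ∀ m, α m ≤ (I.menPref m).length) (m : Fin I.men) :
    I.advance α m ≤ (I.menPref m).length := by
  unfold advance
  split
  · next h =>
    obtain ⟨w, h, -⟩ := h
    exact h.lt
  · exact hα m

theorem stationary_iff : I.Stationary α ↔ I.advance α = α := by
  constructor
  · intro h
    funext m
    exact if_neg fun ⟨w, h₁, h₂⟩ => h m w h₁ h₂
  · intro h m w h₁ h₂
    have := congrFun h m
    rw [advance, if_pos ⟨w, h₁, h₂⟩] at this
    omega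

theorem Better.mono {m : Fin I.men} {w : Fin I.women} (h : α ≤ β) (hb : I.Better α m w) :
    I.Better β m w := by
  obtain ⟨m', h₁, h₂⟩ := hb
  exact ⟨m', h₁.trans (h m'), h₂⟩

theorem acceptable_of_idxOf_lt {m : Fin I.men} {w : Fin I.women}
    (h : (I.womenPref w).idxOf m < (I.womenPref w).length) : I.Acceptable m w := by
  have := List.idxOf_lt_length_iff.1 h
  exact ⟨(I.mem_iff m w).2 this, this⟩

/-- A pair blocks a matching if the man prefers it to his pointer, and the woman, if matched, to her
partner. -/
theorem blocks_of_lt (hμ : I.IsMatching μ) {m : Fin I.men} {w : Fin I.women}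
    (ha : I.Acceptable m w) (h : (I.menPref m).idxOf w < I.vec μ m)
    (h' : ∀ m', (m', w) ∈ μ → (I.womenPref w).idxOf m < (I.womenPref w).idxOf m') :
    I.Blocks μ m w := by
  refine ⟨ha, ?_, ?_⟩
  · by_cases hm : ∃ w', (m, w') ∈ μ
    · obtain ⟨w', hw'⟩ := hm
      rw [vec_of_mem hμ hw'] at h
      exact .inr ⟨w', hw', Nat.succ_lt_succ h⟩
    · exact .inl (by simpa using hm)
  · by_cases hm : ∃ m', (m', w) ∈ μ
    · obtain ⟨m', hm'⟩ := hm
      exact .inr ⟨m', hm', Nat.succ_lt_succ (h' m' hm')⟩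
    · exact .inl (by simpa using hm)

/-- A round of proposals does not move the pointers past a stable matching: a man rejected by his
partner in that matching would be replaced by a blocking pair. -/
theorem advance_le_vec (hμ : I.IsStable μ) (h : α ≤ I.vec μ) : I.advance α ≤ I.vec μ := by
  intro m
  unfold advance
  split
  · next hm =>
    obtain ⟨w, hp, m', h₁, h₂⟩ := hm
    refine Nat.lt_of_le_of_ne (h m) fun heq => ?_
    have hmem : (m, w) ∈ μ := (points_vec hμ.1).1 ⟨hp.1, hp.2.trans heq⟩
    have ha : I.Acceptable m' w := acceptable_of_idxOf_lt (h₂.trans_le List.idxOf_le_length)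
    refine hμ.2 m' w (blocks_of_lt hμ.1 ha (lt_of_le_of_ne (h₁.trans (h m')) fun heq' => ?_) ?_)
    · have := hμ.1.man_unique _ _ _ ((points_vec hμ.1).1 ⟨ha.1, heq'⟩) hmem
      rw [this] at h₂
      omega
    · intro m'' hm''
      rwa [hμ.1.man_unique _ _ _ hm'' hmem]
  · exact h m

theorem Stationary.isMatching (hα : I.Stationary α) : I.IsMatching (I.pairs α) where
  acceptable m w h := by
    have := (mem_pairs.1 h).1
    exact ⟨this, (I.mem_iff m w).1 this⟩
  woman_unique m w w' h h' := (mem_pairs.1 h).unique (mem_pairs.1 h')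
  man_unique m m' w h h' := by
    rw [mem_pairs] at h h'
    have hm := (I.mem_iff m w).1 h.1
    refine (List.idxOf_inj hm).1 ?_
    rcases lt_trichotomy ((I.womenPref w).idxOf m) ((I.womenPref w).idxOf m') with hlt | heq | hlt
    · exact absurd ⟨m, h.2.le, hlt⟩ (hα m' w h')
    · exact heq
    · exact absurd ⟨m', h'.2.le, hlt⟩ (hα m w h)

/-- Stationary justified pointers give a stable matching: the best man who has reached a woman has
not passed her. -/
theorem Stationary.isStable (hα : I.Stationary α) (hj : I.Justified α) :
    I.IsStable (I.pairs α) := by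
  refine ⟨hα.isMatching, fun m w ⟨ha, h₁, h₂⟩ => ?_⟩
  have hlt : (I.menPref m).idxOf w < α m := by
    rcases h₁ with h | ⟨w', hw', h⟩
    · have : ¬ α m < (I.menPref m).length := by
        rw [← exists_points_iff]
        simpa using h
      have := List.idxOf_lt_length_iff.2 ha.1
      omega
    · rw [← (mem_pairs.1 hw').2]
      exact Nat.lt_of_succ_lt_succ h
  obtain ⟨m₁, h₃, h₄⟩ := hj m w ha.1 hlt
  obtain ⟨b, hb, hmin⟩ := Finset.exists_min_image
    (Finset.univ.filter fun m' => (I.menPref m').idxOf w ≤ α m')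
    (fun m' => (I.womenPref w).idxOf m') ⟨m₁, by simpa using h₃⟩
  simp only [Finset.mem_filter, Finset.mem_univ, true_and] at hb hmin
  have hbm : (I.womenPref w).idxOf b < (I.womenPref w).idxOf m := (hmin m₁ h₃).trans_lt h₄
  have hab : I.Acceptable b w := acceptable_of_idxOf_lt (hbm.trans_le List.idxOf_le_length)
  have hp : I.Points α b w := by
    refine ⟨hab.1, le_antisymm hb (not_lt.1 fun h => ?_)⟩
    obtain ⟨m₂, h₅, h₆⟩ := hj b w hab.1 h
    have := hmin m₂ h₅
    omega
  rcases h₂ with h₂ | ⟨m', hm', h⟩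
  · exact h₂ b (mem_pairs.2 hp)
  · rw [hα.isMatching.man_unique _ _ _ hm' (mem_pairs.2 hp)] at h
    have := Nat.lt_of_succ_lt_succ h
    omega

theorem Justified.advance (hj : I.Justified α) : I.Justified (I.advance α) := by
  intro m w hw hlt
  by_cases h : (I.menPref m).idxOf w < α m
  · exact (hj m w hw h).mono le_advance
  · unfold Instance.advance at hlt
    split at hlt
    · next h' =>
      obtain ⟨w', h₁, h₂⟩ := h'
      have : I.Points α m w := ⟨hw, by omega⟩
      rw [this.unique h₁]
      exact h₂.mono le_advance
    · exact absurd hlt h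

theorem justified_zero : I.Justified 0 := fun _ _ _ h => absurd h (Nat.not_lt_zero _)

/-- A stable matching passes the test of the algorithm: a woman passed by a man would form a
blocking pair with him if she were not matched to someone better. -/
theorem justified_vec (hμ : I.IsStable μ) : I.Justified (I.vec μ) := by
  intro m w hw hlt
  have ha : I.Acceptable m w := ⟨hw, (I.mem_iff m w).1 hw⟩
  by_contra hb
  refine hμ.2 m w (blocks_of_lt hμ.1 ha hlt fun m' hm' => ?_)
  by_contra h
  refine hb ⟨m', (vec_of_mem hμ.1 hm').ge, lt_of_le_of_ne (not_lt.1 h) fun heq => ?_⟩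
  have := vec_of_mem hμ.1 hm'
  rw [(List.idxOf_inj ((I.mem_iff m' w).1 (hμ.1.acceptable _ _ hm').1)).1 heq] at this
  omega

/-- After as many rounds as the total length of the lists, the pointers are stationary. -/
theorem stationary_iterate (hα : ∀ m, α m ≤ (I.menPref m).length) :
    I.Stationary (I.advance^[∑ m, (I.menPref m).length] α) := by
  have hle : ∀ k m, (I.advance^[k] α) m ≤ (I.menPref m).length := by
    intro k
    induction k with
    | zero => exact hα
    | succ k ih => rw [Function.iterate_succ_apply']; exact advance_le ih
  -- Until the pointers are stationary, their sum grows by at least one in every round.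
  have hgrow : ∀ k, I.Stationary (I.advance^[k] α) ∨ k ≤ ∑ m, (I.advance^[k] α) m := by
    intro k
    induction k with
    | zero => exact .inr (Nat.zero_le _)
    | succ k ih =>
      rw [Function.iterate_succ_apply']
      by_cases hs : I.Stationary (I.advance^[k] α)
      · left
        rwa [stationary_iff.1 hs]
      · right
        have hk := ih.resolve_left hs
        have hlt : I.advance^[k] α < I.advance (I.advance^[k] α) :=
          lt_of_le_of_ne le_advance fun h => hs (stationary_iff.2 h.symm)
        obtain ⟨h₁, m, h₂⟩ := Pi.lt_def.1 hlt
        have := Finset.sum_lt_sum (fun i _ => h₁ i) ⟨m, Finset.mem_univ m, h₂⟩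
        omega
  rcases hgrow (∑ m, (I.menPref m).length) with h | h
  · exact h
  · intro m w hp
    have h' := (Finset.sum_eq_sum_iff_of_le fun i _ => hle _ i).1
      (le_antisymm (Finset.sum_le_sum fun i _ => hle _ i) h) m (Finset.mem_univ m)
    have := hp.lt
    omega

/-! ### Exchanging the sides -/

/-- The pairs with the roles of men and women exchanged. -/
def swapPairs {a b : ℕ} (μ : Finset (Fin a × Fin b)) : Finset (Fin b × Fin a) :=
  μ.map (Equiv.prodComm _ _).toEmbedding

@[simp] theorem mem_swapPairs {a b : ℕ} {μ : Finset (Fin a × Fin b)} {m : Fin a} {w : Fin b} :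
    (w, m) ∈ swapPairs μ ↔ (m, w) ∈ μ := by
  simp [swapPairs]

@[simp] theorem swapPairs_swapPairs {a b : ℕ} (μ : Finset (Fin a × Fin b)) :
    swapPairs (swapPairs μ) = μ := by
  ext ⟨m, w⟩
  simp

theorem sum_swapPairs {a b : ℕ} (μ : Finset (Fin a × Fin b)) (f : Fin a → Fin b → ℕ) :
    ∑ e ∈ swapPairs μ, f e.2 e.1 = ∑ e ∈ μ, f e.1 e.2 := by
  simp [swapPairs]

theorem IsMatching.swap (h : I.IsMatching μ) : I.swap.IsMatching (swapPairs μ) where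
  acceptable _ _ hm := (h.acceptable _ _ (mem_swapPairs.1 hm)).symm
  woman_unique _ _ _ h₁ h₂ := h.man_unique _ _ _ (mem_swapPairs.1 h₁) (mem_swapPairs.1 h₂)
  man_unique _ _ _ h₁ h₂ := h.woman_unique _ _ _ (mem_swapPairs.1 h₁) (mem_swapPairs.1 h₂)

theorem IsStable.swap (h : I.IsStable μ) : I.swap.IsStable (swapPairs μ) := by
  refine ⟨h.1.swap, fun m w hb => h.2 w m ⟨hb.1.symm, ?_, ?_⟩⟩
  · have := hb.2.2
    simp only [mem_swapPairs] at this
    exact this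
  · have := hb.2.1
    simp only [mem_swapPairs] at this
    exact this

theorem isWomanOptimal_iff : I.IsWomanOptimal μ ↔ I.swap.IsManOptimal (swapPairs μ) := by
  constructor
  · rintro ⟨h₁, h₂⟩
    refine ⟨h₁.swap, fun ν hν w => ?_⟩
    have := h₂ _ hν.swap w
    simp only [mem_swapPairs] at this ⊢
    exact this
  · rintro ⟨h₁, h₂⟩
    have := h₁.swap
    rw [swapPairs_swapPairs] at this
    refine ⟨this, fun ν hν w => ?_⟩
    have := h₂ _ hν.swap w
    simp only [mem_swapPairs] at this ⊢
    exact this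

theorem womenCost_eq : I.womenCost μ = I.swap.menCost (swapPairs μ) :=
  (sum_swapPairs μ fun m w => I.womenPos w m).symm

theorem OW_eq : I.OW = I.swap.OM := by
  unfold OW OM
  congr 1
  ext c
  constructor
  · rintro ⟨μ, h, rfl⟩
    exact ⟨_, isWomanOptimal_iff.1 h, womenCost_eq.symm⟩
  · rintro ⟨μ, h, rfl⟩
    refine ⟨swapPairs μ, isWomanOptimal_iff.2 (by simpa using h), ?_⟩
    rw [womenCost_eq, swapPairs_swapPairs]

/-! ### Costs, and the man-optimal matching -/

theorem sum_pairs (α : Fin I.men → ℕ) (f : Fin I.men → Fin I.women → ℕ) :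
    ∑ e ∈ I.pairs α, f e.1 e.2 =
      ∑ m, if h : α m < (I.menPref m).length then f m (I.menPref m)[α m] else 0 := by
  classical
  rw [pairs, Finset.sum_filter, Fintype.sum_prod_type]
  refine Finset.sum_congr rfl fun m _ => ?_
  split
  · next h =>
    rw [Finset.sum_eq_single (I.menPref m)[α m]]
    · rw [if_pos (points_iff.2 ⟨h, rfl⟩)]
    · intro w _ hw
      exact if_neg fun hp => hw (points_iff.1 hp).2.symm
    · simp
  · next h =>
    exact Finset.sum_eq_zero fun w _ => if_neg fun hp => h hp.lt

variable (I) in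
/-- The cost, for the men, of the pairs given by a pointer vector. -/
def vecCost (α : Fin I.men → ℕ) : ℕ :=
  ∑ m, if α m < (I.menPref m).length then α m + 1 else 0

theorem menCost_pairs (α : Fin I.men → ℕ) : I.menCost (I.pairs α) = I.vecCost α := by
  unfold menCost vecCost
  rw [sum_pairs α]
  refine Finset.sum_congr rfl fun m _ => ?_
  split
  · next h => rw [menPos, (I.menPref_nodup m).idxOf_getElem]
  · rfl

theorem menCost_eq (hμ : I.IsMatching μ) : I.menCost μ = I.vecCost (I.vec μ) := by
  rw [← menCost_pairs, pairs_vec hμ]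

theorem sum_of_isMatching (hμ : I.IsMatching μ) (f : Fin I.men → ℕ) :
    ∑ e ∈ μ, f e.1 = ∑ m, if I.vec μ m < (I.menPref m).length then f m else 0 := by
  conv_lhs => rw [← pairs_vec hμ]
  rw [sum_pairs (I.vec μ) fun m _ => f m]
  simp

/-- Stationary pointers match the same men as any stable matching `μ` above them; in particular, all
stable matchings match the same men. The pointers match at least the men matched by `μ`, and at most
the women, and in a matching there are as many men as women. -/
theorem points_iff_matched (hα : I.Stationary α) (hμ : I.IsStable μ) (h : α ≤ I.vec μ)
    (m : Fin I.men) : α m < (I.menPref m).length ↔ I.vec μ m < (I.menPref m).length := by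
  classical
  have hM := hα.isMatching
  have card : ∀ {ν}, I.IsMatching ν → (ν.image Prod.fst).card = ν.card ∧
      (ν.image Prod.snd).card = ν.card := by
    intro ν hν
    constructor
    · refine Finset.card_image_of_injOn ?_
      rintro ⟨m, w⟩ h₁ ⟨m', w'⟩ h₂ (rfl : m = m')
      rw [hν.woman_unique _ _ _ h₁ h₂]
    · refine Finset.card_image_of_injOn ?_
      rintro ⟨m, w⟩ h₁ ⟨m', w'⟩ h₂ (rfl : w = w')
      rw [hν.man_unique _ _ _ h₁ h₂]
  have hmem : ∀ {ν}, I.IsMatching ν → ∀ m, m ∈ ν.image Prod.fst ↔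
      I.vec ν m < (I.menPref m).length := by
    intro ν hν m
    rw [← exists_points_iff]
    simp [points_vec hν]
  have hmem' : ∀ m, m ∈ (I.pairs α).image Prod.fst ↔ α m < (I.menPref m).length := by
    intro m
    rw [← exists_points_iff]
    simp
  have hmen : μ.image Prod.fst ⊆ (I.pairs α).image Prod.fst := fun m hm => by
    rw [hmem hμ.1] at hm
    rw [hmem']
    exact (h m).trans_lt hm
  have hwomen : (I.pairs α).image Prod.snd ⊆ μ.image Prod.snd := by
    intro w hw
    simp only [Finset.mem_image, Prod.exists, exists_eq_right, mem_pairs] at hw ⊢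
    obtain ⟨m, hp⟩ := hw
    by_contra hno
    push Not at hno
    refine hμ.2 m w (blocks_of_lt hμ.1 ⟨hp.1, (I.mem_iff m w).1 hp.1⟩
      (lt_of_le_of_ne (hp.2 ▸ h m) fun heq => ?_) fun m' hm' => absurd hm' (hno m'))
    exact hno m ((points_vec hμ.1).1 ⟨hp.1, heq⟩)
  have h₁ := Finset.card_le_card hwomen
  rw [(card hM).2, (card hμ.1).2] at h₁
  have := Finset.eq_of_subset_of_card_le hmen (by rw [(card hM).1, (card hμ.1).1]; exact h₁)
  rw [← hmem', ← this, hmem hμ.1]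

variable (I) in
/-- The pointers of the man-optimal matching: proposals are made until nobody is rejected. -/
noncomputable def opt : Fin I.men → ℕ := I.advance^[∑ m, (I.menPref m).length] 0

theorem iterate_le_vec (hμ : I.IsStable μ) (h : α ≤ I.vec μ) (k : ℕ) :
    I.advance^[k] α ≤ I.vec μ := by
  induction k with
  | zero => exact h
  | succ k ih => rw [Function.iterate_succ_apply']; exact advance_le_vec hμ ih

theorem le_iterate (k : ℕ) : α ≤ I.advance^[k] α := by
  induction k with
  | zero => exact le_rfl
  | succ k ih => rw [Function.iterate_succ_apply']; exact ih.trans le_advance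

theorem iterate_le_length (hα : ∀ m, α m ≤ (I.menPref m).length) (k : ℕ) (m : Fin I.men) :
    (I.advance^[k] α) m ≤ (I.menPref m).length := by
  induction k generalizing m with
  | zero => exact hα m
  | succ k ih => rw [Function.iterate_succ_apply']; exact advance_le ih m

theorem opt_le_length (m : Fin I.men) : I.opt m ≤ (I.menPref m).length :=
  iterate_le_length (by simp) _ m

theorem stationary_opt : I.Stationary I.opt := stationary_iterate (by simp)

theorem isStable_opt : I.IsStable (I.pairs I.opt) := by
  refine stationary_opt.isStable ?_
  unfold opt
  generalize ∑ m, (I.menPref m).length = k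
  induction k with
  | zero => exact justified_zero
  | succ k ih => rw [Function.iterate_succ_apply']; exact ih.advance

theorem opt_le_vec (hμ : I.IsStable μ) : I.opt ≤ I.vec μ :=
  iterate_le_vec hμ (fun _ => Nat.zero_le _) _

theorem isManOptimal_opt : I.IsManOptimal (I.pairs I.opt) := by
  refine ⟨isStable_opt, fun μ hμ m => ?_⟩
  have h := points_iff_matched stationary_opt hμ (opt_le_vec hμ) m
  rw [← exists_points_iff, ← exists_points_iff] at h
  simp only [points_vec hμ.1] at h
  by_cases hm : ∃ w, I.Points I.opt m w
  · obtain ⟨w₀, h₀⟩ := hm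
    obtain ⟨w, hw⟩ := h.1 ⟨w₀, h₀⟩
    refine .inr ⟨w₀, w, mem_pairs.2 h₀, hw, Nat.succ_le_succ ?_⟩
    rw [h₀.2, ← vec_of_mem hμ.1 hw]
    exact opt_le_vec hμ m
  · have hm' := mt h.2 hm
    push Not at hm hm'
    exact .inl ⟨by simpa using hm, hm'⟩

theorem IsManOptimal.vec_eq (hμ : I.IsManOptimal μ) : I.vec μ = I.opt := by
  refine le_antisymm (fun m => ?_) (opt_le_vec hμ.1)
  rcases hμ.2 _ isStable_opt m with ⟨-, h⟩ | ⟨w₀, w, h₀, h, hle⟩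
  · have : ¬ I.opt m < (I.menPref m).length := by
      rw [← exists_points_iff]
      simpa using h
    exact vec_le m |>.trans (not_lt.1 this)
  · rw [vec_of_mem hμ.1.1 h₀, ← (mem_pairs.1 h).2]
    exact Nat.le_of_succ_le_succ hle

theorem OM_eq : I.OM = I.vecCost I.opt := by
  have : {c | ∃ μ, I.IsManOptimal μ ∧ I.menCost μ = c} = {I.vecCost I.opt} := by
    ext c
    constructor
    · rintro ⟨μ, hμ, rfl⟩
      rw [Set.mem_singleton_iff, menCost_eq hμ.1.1, hμ.vec_eq]
    · rintro rfl
      exact ⟨_, isManOptimal_opt, menCost_pairs _⟩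
  rw [OM, this, csInf_singleton]

theorem OW_eq_vecCost : I.OW = I.swap.vecCost I.swap.opt := by rw [OW_eq, OM_eq]

/-- The sum of the pointers of a stable matching exceeds its minimum exactly as much as the cost
does, as all stable matchings match the same men. -/
theorem sum_vec_add_OM (hμ : I.IsStable μ) :
    ∑ m, I.vec μ m + I.OM = I.menCost μ + ∑ m, I.opt m := by
  rw [OM_eq, menCost_eq hμ.1, vecCost, vecCost, ← Finset.sum_add_distrib, ← Finset.sum_add_distrib]
  refine Finset.sum_congr rfl fun m _ => ?_
  have h := points_iff_matched stationary_opt hμ (opt_le_vec hμ) m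
  have h₁ := opt_le_length m
  have h₂ := vec_le (μ := μ) m
  split <;> split <;> omega

/-- If `F` counts men matched by `μ` whose wives do not get their best stable partner, then the cost
of `μ` for the women exceeds its minimum by at least the sum of `F`. -/
theorem sum_add_OW_le (hμ : I.IsStable μ) (F : Fin I.men → ℕ) (hF : ∀ m, F m ≤ 1)
    (hF' : ∀ m, F m ≠ 0 → ∃ w, (m, w) ∈ μ ∧ I.swap.opt w ≠ (I.womenPref w).idxOf m) :
    ∑ m, F m + I.OW ≤ I.womenCost μ := by
  have hs := hμ.swap
  have h₁ : ∑ m, F m = ∑ e ∈ μ, F e.1 := by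
    rw [sum_of_isMatching hμ.1]
    refine Finset.sum_congr rfl fun m _ => ?_
    split
    · rfl
    · next h =>
      by_contra hne
      obtain ⟨w, hw, -⟩ := hF' m hne
      exact h (exists_points_iff.1 ⟨w, (points_vec hμ.1).2 hw⟩)
  have h₂ : ∑ e ∈ μ, F e.1 ≤
      ∑ e ∈ μ, (I.swap.vec (swapPairs μ) e.2 - I.swap.opt e.2) := by
    refine Finset.sum_le_sum fun ⟨m, w⟩ he => ?_
    by_cases hm : F m = 0
    · simp [hm]
    · obtain ⟨w', hw', hne⟩ := hF' m hm
      rw [hμ.1.woman_unique _ _ _ hw' he] at hne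
      have h₃ := opt_le_vec hs w
      rw [vec_of_mem hs.1 (mem_swapPairs.2 he)] at h₃ ⊢
      have := hF m
      simp only
      change I.swap.opt w ≤ (I.womenPref w).idxOf m at h₃
      change F m ≤ (I.womenPref w).idxOf m - I.swap.opt w
      omega
  have h₃ : ∑ e ∈ μ, (I.swap.vec (swapPairs μ) e.2 - I.swap.opt e.2) =
      ∑ w, if I.swap.vec (swapPairs μ) w < (I.swap.menPref w).length
        then I.swap.vec (swapPairs μ) w - I.swap.opt w else 0 := by
    rw [← sum_of_isMatching hs.1 fun w => I.swap.vec (swapPairs μ) w - I.swap.opt w,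
      ← sum_swapPairs μ fun m w => I.swap.vec (swapPairs μ) w - I.swap.opt w]
  rw [womenCost_eq, menCost_eq hs.1, OW_eq_vecCost, h₁]
  refine (Nat.add_le_add_right (h₂.trans h₃.le) _).trans ?_
  rw [vecCost, vecCost, ← Finset.sum_add_distrib]
  refine Finset.sum_le_sum fun w _ => ?_
  have h := points_iff_matched stationary_opt hs (opt_le_vec hs) w
  have h₁ : I.swap.opt w ≤ I.swap.vec (swapPairs μ) w := opt_le_vec hs w
  split <;> split <;> omega

/-- A stationary lower bound of a stable matching is the matching itself, if every man either points
at his partner, or at a woman whose best stable partner he is: such a pair blocks any stable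
matching in which the man gets someone worse. -/
theorem eq_vec_of_forall (hμ : I.IsStable μ)
    (h : α ≤ I.vec μ) (hw : ∀ m w, I.Points α m w → α m = I.vec μ m ∨
      I.swap.opt w = (I.womenPref w).idxOf m) : α = I.vec μ := by
  funext m
  by_contra hne
  have hlt := lt_of_le_of_ne (h m) hne
  obtain ⟨w, hp⟩ := exists_points_iff.2 (hlt.trans_le (vec_le m))
  have hopt := (hw m w hp).resolve_left hne
  refine hμ.2 m w (blocks_of_lt hμ.1 ⟨hp.1, (I.mem_iff m w).1 hp.1⟩ (hp.2 ▸ hlt) fun m' hm' => ?_)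
  have h₁ := opt_le_vec hμ.swap w
  rw [vec_of_mem hμ.swap.1 (mem_swapPairs.2 hm'), hopt] at h₁
  refine lt_of_le_of_ne h₁ fun heq => hne ?_
  rw [← (List.idxOf_inj ((I.mem_iff m w).1 hp.1)).1 heq] at hm'
  rw [vec_of_mem hμ.1 hm', hp.2]

end Instance

open Instance

/-! ### Correctness of the functions on lists -/

section Translation

theorem map_range_eq {β : Type} (n : ℕ) (f : ℕ → β) :
    (List.range n).map f = List.ofFn fun i : Fin n => f i :=
  List.ext_getElem (by simp) (by simp)

theorem getD_ofFn {β : Type} {n : ℕ} (v : Fin n → β) (i : Fin n) (d : β) :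
    (List.ofFn v).getD i d = v i := by simp

theorem idxOf_map_val {n : ℕ} (l : List (Fin n)) (i : Fin n) :
    (l.map Fin.val).idxOf (i : ℕ) = l.idxOf i := by
  induction l with
  | nil => simp
  | cons a l ih =>
    by_cases h : a = i
    · simp [h]
    · rw [List.map_cons, List.idxOf_cons_ne _ (by simpa [Fin.ext_iff] using h),
        List.idxOf_cons_ne _ h, ih]

variable (I : Instance) (α F : Fin I.men → ℕ)

/-- The lists of the men, as lists of natural numbers. Those of the women are `I.swap.prefLists`. -/
def Instance.prefLists : List (List ℕ) := List.ofFn fun m => (I.menPref m).map Fin.val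

@[simp] theorem length_prefLists : I.prefLists.length = I.men := by simp [prefLists]

@[simp] theorem getD_prefLists (m : Fin I.men) :
    I.prefLists.getD m [] = (I.menPref m).map Fin.val := getD_ofFn _ _ _

variable {I}

theorem better_iff (m : Fin I.men) (w : Fin I.women) :
    better I.prefLists I.swap.prefLists (List.ofFn α) m w = true ↔ I.Better α m w := by
  unfold better Better
  have h₁ := getD_prefLists I.swap w
  simp only [List.any_eq_true, List.mem_range, length_prefLists, Bool.and_eq_true,
    decide_eq_true_eq, h₁]
  constructor
  · rintro ⟨m', hm', h₂, h₃⟩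
    lift m' to Fin I.men using hm'
    rw [getD_ofFn, getD_prefLists, idxOf_map_val] at h₂
    erw [idxOf_map_val, idxOf_map_val] at h₃
    exact ⟨m', h₂, h₃⟩
  · rintro ⟨m', h₂, h₃⟩
    refine ⟨m', m'.2, ?_, ?_⟩
    · rwa [getD_ofFn, getD_prefLists, idxOf_map_val]
    · erw [idxOf_map_val, idxOf_map_val]
      exact h₃

theorem pointing_iff (m : Fin I.men) :
    pointing I.prefLists (List.ofFn α) m = true ↔ α m < (I.menPref m).length := by
  rw [pointing, getD_ofFn, getD_prefLists, List.length_map, decide_eq_true_eq]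

theorem target_eq {α : Fin I.men → ℕ} {m : Fin I.men} {w : Fin I.women} (h : I.Points α m w) :
    target I.prefLists (List.ofFn α) m = w := by
  obtain ⟨h₁, rfl⟩ := points_iff.1 h
  rw [target, getD_ofFn, getD_prefLists]
  simp [h₁]

theorem bump_ofFn (n : ℕ) (p : ℕ → Bool) (v : Fin n → ℕ) :
    bump n p (List.ofFn v) = List.ofFn fun i => bif p i then v i + 1 else v i := by
  rw [bump, map_range_eq]
  simp only [getD_ofFn]

theorem round_ofFn :
    round I.prefLists I.swap.prefLists (List.ofFn α) = List.ofFn (I.advance α) := by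
  rw [round, length_prefLists, bump_ofFn]
  congr 1
  funext m
  have h : (pointing I.prefLists (List.ofFn α) m && better I.prefLists I.swap.prefLists
      (List.ofFn α) m (target I.prefLists (List.ofFn α) m)) = true ↔
      ∃ w, I.Points α m w ∧ I.Better α m w := by
    rw [Bool.and_eq_true, pointing_iff, ← exists_points_iff]
    constructor
    · rintro ⟨⟨w, h₁⟩, h₂⟩
      rw [target_eq h₁, better_iff] at h₂
      exact ⟨w, h₁, h₂⟩
    · rintro ⟨w, h₁, h₂⟩
      exact ⟨⟨w, h₁⟩, by rwa [target_eq h₁, better_iff]⟩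
  classical
  rw [advance, Bool.cond_eq_ite]
  exact if_congr h rfl rfl

theorem total_prefLists : total I.prefLists = ∑ m, (I.menPref m).length := by
  rw [total, prefLists, List.map_ofFn, List.sum_ofFn]
  simp

theorem propose_ofFn : propose I.prefLists I.swap.prefLists (List.ofFn α) =
    List.ofFn (I.advance^[∑ m, (I.menPref m).length] α) := by
  rw [propose, total_prefLists]
  generalize ∑ m, (I.menPref m).length = k
  induction k with
  | zero => simp
  | succ k ih =>
    rw [List.range_succ, List.foldl_append, ih, Function.iterate_succ_apply']
    exact round_ofFn _

theorem justified_iff {α : Fin I.men → ℕ} (hα : ∀ m, α m ≤ (I.menPref m).length) :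
    justified I.prefLists I.swap.prefLists (List.ofFn α) = true ↔ I.Justified α := by
  simp only [justified, List.all_eq_true, List.mem_range, length_prefLists]
  constructor
  · intro h m w hw hlt
    have := h m m.2 ((I.menPref m).idxOf w) (by rwa [getD_ofFn])
    rw [getD_prefLists] at this
    have hlt' := hlt.trans_le (hα m)
    rw [← better_iff]
    simpa [hlt'] using this
  · intro h m hm i hi
    lift m to Fin I.men using hm
    rw [getD_ofFn] at hi
    have hi' := hi.trans_le (hα m)
    have := h m (I.menPref m)[i] (List.getElem_mem hi')
      (by rwa [(I.menPref_nodup m).idxOf_getElem _ hi'])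
    rw [← better_iff] at this
    rw [getD_prefLists]
    simpa [hi'] using this

theorem ownCost_ofFn : ownCost I.prefLists (List.ofFn α) = I.vecCost α := by
  rw [ownCost, length_prefLists, map_range_eq, List.sum_ofFn, vecCost]
  refine Finset.sum_congr rfl fun m _ => ?_
  rw [Bool.cond_eq_ite, getD_ofFn]
  exact if_congr (pointing_iff α m) rfl rfl

theorem otherCost_ofFn : otherCost I.prefLists I.swap.prefLists (List.ofFn α) =
    I.womenCost (I.pairs α) := by
  rw [otherCost, length_prefLists, map_range_eq, List.sum_ofFn, womenCost,
    sum_pairs α fun m w => I.womenPos w m]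
  refine Finset.sum_congr rfl fun m _ => ?_
  rw [Bool.cond_eq_ite]
  split
  · next h =>
    rw [pointing_iff] at h
    have hp : I.Points α m (I.menPref m)[α m] := points_iff.2 ⟨h, rfl⟩
    rw [target_eq hp, dif_pos h, womenPos]
    have := getD_prefLists I.swap (I.menPref m)[α m]
    rw [this]
    erw [idxOf_map_val]
  · next h =>
    rw [pointing_iff] at h
    rw [dif_neg h]

theorem good_iff {α : Fin I.men → ℕ} (hα : ∀ m, α m ≤ (I.menPref m).length) (K : ℕ) :
    good I.prefLists I.swap.prefLists K (List.ofFn α) = true ↔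
      I.Justified α ∧ I.menCost (I.pairs α) ≤ K ∧ I.womenCost (I.pairs α) ≤ K := by
  simp [good, justified_iff hα, ownCost_ofFn, otherCost_ofFn, menCost_pairs]

theorem zeros_eq (n : ℕ) : zeros n = List.ofFn (0 : Fin n → ℕ) := map_range_eq _ _

theorem mem_candidates (u : Fin I.women → ℕ) (m : ℕ) :
    m ∈ candidates I.prefLists I.swap.prefLists (List.ofFn u) (List.ofFn α) (List.ofFn F) ↔
      ∃ (m' : Fin I.men) (w : Fin I.women), m = m' ∧ I.Points α m' w ∧ F m' = 0 ∧
        u w ≠ (I.womenPref w).idxOf m' := by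
  have key : ∀ (m' : Fin I.men) (w : Fin I.women), I.Points α m' w →
      ((List.ofFn u).getD (target I.prefLists (List.ofFn α) m') 0 =
        (I.swap.prefLists.getD (target I.prefLists (List.ofFn α) m') []).idxOf (m' : ℕ) ↔
      u w = (I.womenPref w).idxOf m') := by
    intro m' w hp
    rw [target_eq hp, getD_ofFn]
    have := getD_prefLists I.swap w
    rw [this]
    erw [idxOf_map_val]
  simp only [candidates, List.mem_filter, List.mem_range, length_prefLists, Bool.and_eq_true,
    decide_eq_true_eq, Bool.not_eq_true', decide_eq_false_iff_not]
  constructor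
  · rintro ⟨hm, h₁, h₂, h₃⟩
    lift m to Fin I.men using hm
    rw [pointing_iff, ← exists_points_iff] at h₁
    obtain ⟨w, hp⟩ := h₁
    rw [getD_ofFn] at h₂
    rw [key m w hp] at h₃
    exact ⟨m, w, rfl, hp, h₂, h₃⟩
  · rintro ⟨m, w, rfl, hp, h₂, h₃⟩
    rw [pointing_iff, getD_ofFn, key m w hp]
    exact ⟨m.2, hp.lt, h₂, h₃⟩

theorem capBits_bits (c k : ℕ) : capBits c k.bits = min c k := by
  induction k using Nat.binaryRec' with
  | zero => simp [capBits]
  | bit b n h ih =>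
    have : capBits c (b :: n.bits) = bif decide (capBits c n.bits + capBits c n.bits +
        (bif b then 1 else 0) ≤ c) then capBits c n.bits + capBits c n.bits +
        (bif b then 1 else 0) else c := by
      simp [capBits]
    rw [Nat.bits_append_bit n b h, this, ih, Nat.bit_val, Bool.cond_decide]
    cases b <;> simp only [cond_true, cond_false, Bool.toNat_true, Bool.toNat_false] <;>
      split <;> omega

theorem encode_eq (I : Instance) (k : ℕ) :
    encode I k = enc (k.bits, I.prefLists, I.swap.prefLists, ()) := by
  have h : ∀ I : Instance, encPref I.menPref = enc I.prefLists := by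
    intro I
    have hl : ∀ l : List (Fin I.women), l.flatMap (fun a => [a.val]) = l.map Fin.val :=
      fun l => List.map_eq_flatMap.symm
    simp [encPref, enc, prefLists, List.map_ofFn, Function.comp_def, hl]
  have h₂ := h I.swap
  rw [encode, encList, enc_pair, enc_pair, enc_pair, ← h, ← h₂]
  rfl

end Translation

/-! ### The search tree -/

section Search

variable (I : Instance) (K : ℕ)

/-- The data that the search needs. -/
noncomputable def context : List (List ℕ) × List (List ℕ) × List ℕ × List ℕ × ℕ :=
  (I.prefLists, I.swap.prefLists, List.ofFn I.opt, List.ofFn I.swap.opt, K)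

/-- The nodes of the search tree consist of a pointer vector and a set of marked men. -/
def IsNode (p : List ℕ × List ℕ) : Prop :=
  ∃ α F : Fin I.men → ℕ, p = (List.ofFn α, List.ofFn F) ∧ (∀ m, α m ≤ (I.menPref m).length) ∧
    ∀ m, F m ≤ 1

/-- The stable matching `μ` is compatible with the node `p`: the pointers are lower bounds for it,
and the marked men have the wives they are pointing at, who do not get their best stable
partners. -/
def Compatible (μ : Finset (Fin I.men × Fin I.women)) (p : List ℕ × List ℕ) : Prop :=
  ∃ α F : Fin I.men → ℕ, p = (List.ofFn α, List.ofFn F) ∧ α ≤ I.vec μ ∧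
    ∀ m, F m ≠ 0 → α m = I.vec μ m ∧
      ∃ w, (m, w) ∈ μ ∧ I.swap.opt w ≠ (I.womenPref w).idxOf m

/-- What is left of the two budgets at a node: how much the pointers may still grow, and how many
men may still be marked, before the node is discarded. Both parts are larger by one than the
remaining budgets, so that they are positive unless the node is discarded: with truncated
subtraction, this is what makes them decrease from a node to its children. -/
noncomputable def budget (p : List ℕ × List ℕ) : ℕ :=
  (K + ∑ m, I.opt m + 1 - I.OM - p.1.sum) + (K + 1 - I.OW - p.2.sum)

/-- A bound for the number of nodes below a given one. -/
noncomputable def weight (p : List ℕ × List ℕ) : ℕ := 2 ^ (budget I K p + 1) - 1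

variable {I K}

theorem visit_context (α F : Fin I.men → ℕ) :
    visit (context I K) (List.ofFn α, List.ofFn F) =
      bif decide (∑ m, (I.advance^[∑ m, (I.menPref m).length] α) m + I.OM ≤ K + ∑ m, I.opt m) &&
        decide (∑ m, F m + I.OW ≤ K) then
        bif good I.prefLists I.swap.prefLists K
          (List.ofFn (I.advance^[∑ m, (I.menPref m).length] α)) then (true, [])
        else (false, branch I.men (candidates I.prefLists I.swap.prefLists (List.ofFn I.swap.opt)
          (List.ofFn (I.advance^[∑ m, (I.menPref m).length] α)) (List.ofFn F))
          (List.ofFn (I.advance^[∑ m, (I.menPref m).length] α)) (List.ofFn F))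
      else (false, []) := by
  have h := ownCost_ofFn (I := I.swap) I.swap.opt
  simp only [visit, context, propose_ofFn, expand, ownCost_ofFn, h, List.sum_ofFn, OM_eq,
    OW_eq_vecCost, length_prefLists]

/-- Increase the entry of `v` at `m` by one. -/
def incr {n : ℕ} (v : Fin n → ℕ) (m : Fin n) : Fin n → ℕ := fun i => if i = m then v i + 1 else v i

theorem sum_incr {n : ℕ} (v : Fin n → ℕ) (m : Fin n) : ∑ i, incr v m i = ∑ i, v i + 1 := by
  have : ∀ i, incr v m i = v i + if i = m then 1 else 0 := by
    intro i
    unfold incr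
    split <;> rfl
  simp [this, Finset.sum_add_distrib]

theorem bump_eq_incr {n : ℕ} (v : Fin n → ℕ) (m : Fin n) :
    bump n (fun i => decide (i = (m : ℕ))) (List.ofFn v) = List.ofFn (incr v m) := by
  rw [bump_ofFn]
  congr 1
  funext i
  simp [incr, Bool.cond_decide, Fin.ext_iff]

/-- The children of a node are obtained from the first candidate. -/
theorem branch_candidates (α F : Fin I.men → ℕ) :
    ((∀ m w, I.Points α m w → F m = 0 → I.swap.opt w = (I.womenPref w).idxOf m) ∧
      branch I.men (candidates I.prefLists I.swap.prefLists (List.ofFn I.swap.opt) (List.ofFn α)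
        (List.ofFn F)) (List.ofFn α) (List.ofFn F) = []) ∨
    ∃ m w, I.Points α m w ∧ F m = 0 ∧ I.swap.opt w ≠ (I.womenPref w).idxOf m ∧
      branch I.men (candidates I.prefLists I.swap.prefLists (List.ofFn I.swap.opt) (List.ofFn α)
        (List.ofFn F)) (List.ofFn α) (List.ofFn F) =
        [(List.ofFn (incr α m), List.ofFn F), (List.ofFn α, List.ofFn (incr F m))] := by
  have hmem := mem_candidates α F I.swap.opt
  generalize candidates I.prefLists I.swap.prefLists (List.ofFn I.swap.opt) (List.ofFn α)
    (List.ofFn F) = c at hmem ⊢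
  cases c with
  | nil =>
    refine .inl ⟨fun m w hp hF => ?_, rfl⟩
    by_contra hne
    exact List.not_mem_nil ((hmem m).2 ⟨m, w, rfl, hp, hF, hne⟩)
  | cons i c =>
    obtain ⟨m, w, rfl, hp, hF, hne⟩ := (hmem i).1 (by simp)
    refine .inr ⟨m, w, hp, hF, hne, ?_⟩
    rw [← bump_eq_incr, ← bump_eq_incr]
    rfl

theorem isNode_child {p : List ℕ × List ℕ} (hp : IsNode I p) :
    ∀ p' ∈ (visit (context I K) p).2, IsNode I p' := by
  obtain ⟨α, F, rfl, hα, hF⟩ := hp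
  rw [visit_context]
  have hα' := iterate_le_length hα (∑ m, (I.menPref m).length)
  generalize I.advance^[∑ m, (I.menPref m).length] α = β at hα' ⊢
  intro p' hp'
  cases h₁ : decide (∑ m, β m + I.OM ≤ K + ∑ m, I.opt m) && decide (∑ m, F m + I.OW ≤ K) with
  | false => simp [h₁] at hp'
  | true =>
    rw [h₁, cond_true] at hp'
    cases h₂ : good I.prefLists I.swap.prefLists K (List.ofFn β) with
    | true => simp [h₂] at hp'
    | false =>
      rw [h₂, cond_false] at hp'
      rcases branch_candidates β F with ⟨-, h⟩ | ⟨m, w, hm, hFm, -, h⟩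
      · simp [h] at hp'
      · rw [h] at hp'
        simp only [List.mem_cons, List.not_mem_nil, or_false] at hp'
        rcases hp' with rfl | rfl
        · refine ⟨_, _, rfl, fun i => ?_, hF⟩
          unfold incr
          split
          · next hi => exact hi ▸ hm.lt
          · exact hα' i
        · refine ⟨_, _, rfl, hα', fun i => ?_⟩
          unfold incr
          split
          · next hi => rw [hi, hFm]
          · exact hF i

theorem length_visit_le (x : List (List ℕ) × List (List ℕ) × List ℕ × List ℕ × ℕ)
    (p : List ℕ × List ℕ) : (visit x p).2.length ≤ 2 := by
  unfold visit expand branch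
  repeat rw [Bool.cond_eq_ite]
  split_ifs <;> simp

/-- A binary tree of depth `b` has at most `2 ^ (b + 1) - 1` nodes, and the budget of a child is
smaller than that of its parent. -/
theorem weight_child {p : List ℕ × List ℕ} (hp : IsNode I p) :
    ((visit (context I K) p).2.map (weight I K)).sum + 1 ≤ weight I K p := by
  have hpos : 1 ≤ weight I K p := by
    have := Nat.pow_le_pow_right (n := 2) (by norm_num) (Nat.le_add_left 1 (budget I K p))
    unfold weight
    omega
  obtain ⟨α, F, rfl, -, -⟩ := hp
  rw [visit_context]
  have hα' : α ≤ I.advance^[∑ m, (I.menPref m).length] α := le_iterate _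
  generalize I.advance^[∑ m, (I.menPref m).length] α = β at hα' ⊢
  cases h₁ : decide (∑ m, β m + I.OM ≤ K + ∑ m, I.opt m) && decide (∑ m, F m + I.OW ≤ K) with
  | false => simpa using hpos
  | true =>
    cases h₂ : good I.prefLists I.swap.prefLists K (List.ofFn β) with
    | true => simpa using hpos
    | false =>
      rcases branch_candidates β F with ⟨-, h⟩ | ⟨m, w, hm, hFm, -, h⟩
      · simpa [h] using hpos
      · rw [cond_true, cond_false, h]
        simp only [Bool.and_eq_true, decide_eq_true_eq] at h₁
        have hsum : ∑ m, α m ≤ ∑ m, β m := Finset.sum_le_sum fun m _ => hα' m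
        have b₁ : budget I K (List.ofFn (incr β m), List.ofFn F) + 1 ≤
            budget I K (List.ofFn α, List.ofFn F) := by
          simp only [budget, List.sum_ofFn, sum_incr]
          omega
        have b₂ : budget I K (List.ofFn β, List.ofFn (incr F m)) + 1 ≤
            budget I K (List.ofFn α, List.ofFn F) := by
          simp only [budget, List.sum_ofFn, sum_incr]
          omega
        have p₁ := Nat.pow_le_pow_right (n := 2) (by norm_num) b₁
        have p₂ := Nat.pow_le_pow_right (n := 2) (by norm_num) b₂
        have p₃ := Nat.one_le_two_pow (n := budget I K (List.ofFn α, List.ofFn F))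
        simp only [List.map_cons, List.map_nil, List.sum_cons, List.sum_nil, weight]
        rw [pow_succ 2 (budget I K (List.ofFn α, List.ofFn F))]
        have p₄ := Nat.one_le_two_pow (n := budget I K (List.ofFn (incr β m), List.ofFn F) + 1)
        have p₅ := Nat.one_le_two_pow (n := budget I K (List.ofFn β, List.ofFn (incr F m)) + 1)
        omega

/-- Success is reported only if there is a stable matching of balance at most `K`. -/
theorem visit_sound {p : List ℕ × List ℕ} (hp : IsNode I p)
    (h : (visit (context I K) p).1 = true) :
    ∃ μ, I.IsStable μ ∧ I.menCost μ ≤ K ∧ I.womenCost μ ≤ K := by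
  obtain ⟨α, F, rfl, hα, -⟩ := hp
  rw [visit_context] at h
  have hα' := iterate_le_length hα (∑ m, (I.menPref m).length)
  have hs := stationary_iterate hα
  generalize I.advance^[∑ m, (I.menPref m).length] α = β at hα' hs h
  cases h₁ : decide (∑ m, β m + I.OM ≤ K + ∑ m, I.opt m) && decide (∑ m, F m + I.OW ≤ K) with
  | false => simp [h₁] at h
  | true =>
    rw [h₁, cond_true] at h
    cases h₂ : good I.prefLists I.swap.prefLists K (List.ofFn β) with
    | false => simp [h₂] at h
    | true =>
      rw [good_iff hα'] at h₂
      exact ⟨_, hs.isStable h₂.1, h₂.2⟩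

/-- The search does not lose a stable matching `μ` of balance at most `K`: a node compatible with
`μ` stays within the budgets, and either reports success or has a child compatible with `μ`. -/
theorem visit_complete {μ : Finset (Fin I.men × Fin I.women)} (hμ : I.IsStable μ)
    (hm : I.menCost μ ≤ K) (hw : I.womenCost μ ≤ K) {p : List ℕ × List ℕ} (hp : IsNode I p)
    (hc : Compatible I μ p) (h : (visit (context I K) p).1 = false) :
    ∃ p' ∈ (visit (context I K) p).2, Compatible I μ p' := by
  obtain ⟨α, F, rfl, hα, hF⟩ := hp
  obtain ⟨α', F', heq, hle, hmark⟩ := hc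
  obtain ⟨h₁, h₂⟩ := Prod.ext_iff.1 heq
  obtain rfl := List.ofFn_injective h₁
  obtain rfl := List.ofFn_injective h₂
  rw [visit_context] at h ⊢
  have hα' := iterate_le_length hα (∑ m, (I.menPref m).length)
  have hle' : α ≤ I.advance^[∑ m, (I.menPref m).length] α := le_iterate _
  have hβ := iterate_le_vec hμ hle (∑ m, (I.menPref m).length)
  generalize I.advance^[∑ m, (I.menPref m).length] α = β at hα' hle' hβ h ⊢
  have hmark' : ∀ m, F m ≠ 0 → β m = I.vec μ m ∧
      ∃ w, (m, w) ∈ μ ∧ I.swap.opt w ≠ (I.womenPref w).idxOf m := by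
    intro m hFm
    obtain ⟨h₁, h₂⟩ := hmark m hFm
    exact ⟨le_antisymm (hβ m) (h₁ ▸ hle' m), h₂⟩
  have b₁ : ∑ m, β m + I.OM ≤ K + ∑ m, I.opt m := by
    have h₁ := sum_vec_add_OM hμ
    have h₂ : ∑ m, β m ≤ ∑ m, I.vec μ m := Finset.sum_le_sum fun m _ => hβ m
    omega
  have b₂ : ∑ m, F m + I.OW ≤ K :=
    (sum_add_OW_le hμ F hF fun m hm => (hmark' m hm).2).trans hw
  simp only [b₁, b₂, decide_true, Bool.and_self, cond_true] at h ⊢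
  cases hg : good I.prefLists I.swap.prefLists K (List.ofFn β) with
  | true => simp [hg] at h
  | false =>
    rw [cond_false]
    rcases branch_candidates β F with ⟨hno, -⟩ | ⟨m, w, hpt, hFm, hne, h⟩
    · -- Without candidates, the pointers give `μ` itself, which the node would have reported.
      exfalso
      have heq : β = I.vec μ := eq_vec_of_forall hμ hβ fun m w hp => by
        by_cases hFm : F m = 0
        · exact .inr (hno m w hp hFm)
        · exact .inl (hmark' m hFm).1
      rw [heq, Bool.eq_false_iff, ne_eq, good_iff vec_le, pairs_vec hμ.1] at hg
      exact hg ⟨justified_vec hμ, hm, hw⟩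
    · rw [h]
      -- The first child is for the case that `m` gets someone worse in `μ` than `w`, the second one
      -- for the case that he gets `w`.
      by_cases hlt : β m < I.vec μ m
      · refine ⟨_, List.mem_cons_self, _, _, rfl, fun i => ?_, fun i hi => ?_⟩
        · unfold incr
          split
          · next hi => exact hi ▸ hlt
          · exact hβ i
        · have : i ≠ m := fun h => hi (h ▸ hFm)
          rw [incr, if_neg this]
          exact hmark' i hi
      · have heq := le_antisymm (hβ m) (not_lt.1 hlt)
        refine ⟨_, List.mem_cons_of_mem _ List.mem_cons_self, _, _, rfl, hβ, fun i hi => ?_⟩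
        by_cases him : i = m
        · subst him
          exact ⟨heq, w, (points_vec hμ.1).1 ⟨hpt.1, hpt.2.trans heq⟩, hne⟩
        · rw [incr, if_neg him] at hi
          exact hmark' i hi

theorem start_eq (I : Instance) (k : ℕ) :
    start (k.bits, I.prefLists, I.swap.prefLists, ()) =
      (context I (min (∑ m, (I.menPref m).length + ∑ w, (I.womenPref w).length) k),
        [(List.ofFn I.opt, List.ofFn (0 : Fin I.men → ℕ))]) := by
  have h := propose_ofFn (I := I.swap) 0
  have h' := length_prefLists I.swap
  have h'' := total_prefLists (I := I.swap)
  simp only [start, context, zeros_eq, length_prefLists, propose_ofFn, h, h', h'', total_prefLists,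
    capBits_bits, opt]

theorem bal_le_iff (I : Instance) (k : ℕ) : I.Bal ≤ k ↔ ∃ μ, I.IsStable μ ∧
    I.menCost μ ≤ min (∑ m, (I.menPref m).length + ∑ w, (I.womenPref w).length) k ∧
    I.womenCost μ ≤ min (∑ m, (I.menPref m).length + ∑ w, (I.womenPref w).length) k := by
  have hcost : ∀ (I : Instance) (μ : Finset (Fin I.men × Fin I.women)), I.IsStable μ →
      I.menCost μ ≤ ∑ m, (I.menPref m).length := by
    intro I μ hμ
    rw [menCost_eq hμ.1]
    refine Finset.sum_le_sum fun m _ => ?_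
    split <;> omega
  have h₁ : I.Bal ≤ k ↔ ∃ μ, I.IsStable μ ∧ I.balance μ ≤ k := by
    constructor
    · intro h
      have hne : Set.Nonempty {b | ∃ μ, I.IsStable μ ∧ I.balance μ = b} :=
        ⟨_, _, isStable_opt, rfl⟩
      obtain ⟨μ, hμ, hb⟩ := Nat.sInf_mem hne
      exact ⟨μ, hμ, hb.trans_le h⟩
    · rintro ⟨μ, hμ, hb⟩
      have hle : I.Bal ≤ I.balance μ := Nat.sInf_le ⟨μ, hμ, rfl⟩
      exact hle.trans hb
  rw [h₁]
  refine exists_congr fun μ => and_congr_right fun hμ => ?_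
  have h₂ := hcost I μ hμ
  have h₃ := hcost I.swap _ hμ.swap
  rw [← womenCost_eq] at h₃
  change I.womenCost μ ≤ ∑ w, (I.womenPref w).length at h₃
  unfold balance
  omega

theorem size_ofFn_nat {n : ℕ} (v : Fin n → ℕ) : size (List.ofFn v) = ∑ i, v i + n := by
  rw [size_list_nat, List.sum_ofFn, List.length_ofFn]

theorem size_node_le {p : List ℕ × List ℕ} (hp : IsNode I p) :
    size p ≤ 4 * size I.prefLists + 1 := by
  obtain ⟨α, F, rfl, hα, hF⟩ := hp
  have h₁ : ∑ m, α m ≤ ∑ m, (I.menPref m).length := Finset.sum_le_sum fun m _ => hα m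
  have h₂ : ∑ m, F m ≤ I.men := by
    simpa using Finset.sum_le_sum fun m (_ : m ∈ Finset.univ) => hF m
  have h₃ := length_le_size I.prefLists
  rw [length_prefLists] at h₃
  have h₄ : ∀ l : List (List ℕ), total l ≤ size l := by
    intro l
    induction l with
    | nil => simp [total]
    | cons a l ih =>
      have := length_le_size a
      simp only [total, List.map_cons, List.sum_cons, size_cons] at ih ⊢
      omega
  have h₅ := h₄ I.prefLists
  rw [total_prefLists] at h₅
  rw [size_pair, size_ofFn_nat, size_ofFn_nat]
  omega

theorem weight_root_le (I : Instance) (c k : ℕ) :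
    weight I (min c k) (List.ofFn I.opt, List.ofFn (0 : Fin I.men → ℕ)) ≤
      8 * 8 ^ (I.param k).toNat := by
  have hb : budget I (min c k) (List.ofFn I.opt, List.ofFn (0 : Fin I.men → ℕ)) + 1 ≤
      2 * (I.param k).toNat + 3 := by
    simp only [budget, List.sum_ofFn, param, Pi.zero_apply, Finset.sum_const_zero]
    omega
  calc weight I (min c k) (List.ofFn I.opt, List.ofFn (0 : Fin I.men → ℕ))
      ≤ 2 ^ (2 * (I.param k).toNat + 3) :=
        (Nat.sub_le _ _).trans (Nat.pow_le_pow_right (by norm_num) hb)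
    _ = 8 * 4 ^ (I.param k).toNat := by rw [pow_add, pow_mul]; norm_num [mul_comm]
    _ ≤ 8 * 8 ^ (I.param k).toNat :=
        Nat.mul_le_mul_left _ (Nat.pow_le_pow_left (by norm_num) _)

end Search

/-! ### The program -/

/-- The program prepares the search, with the context in variable `0`, the stack in variable `1` and
the answer in variable `2`, and then searches. -/
theorem exists_prog :
    ∃ (c : Prog) (p : Polynomial ℕ), ∀ (I : Instance) (k : ℕ),
      AnswersWithin c (encode I k) (I.Bal ≤ k)
        (p.eval (encode I k).numNodes * 8 ^ (I.param k).toNat) := by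
  obtain ⟨r, hr⟩ := PT.start.size_le
  obtain ⟨c₁, q₁, h₁⟩ := PT.start.call
  obtain ⟨c₂, q₂, h₂⟩ := exists_search PT.visit
  refine ⟨.seq (c₁.shift 0) (.seq (.tl 1 0) (.seq (.hd 0 0) (.seq (.nil 2) (.seq c₂ (.copy 0 2))))),
    q₁ + 8 * q₂.comp (r + 4 * .X + 1) + 5, fun I k => ?_⟩
  rw [encode_eq]
  set x := (k.bits, I.prefLists, I.swap.prefLists, ()) with hx
  set K := min (∑ m, (I.menPref m).length + ∑ w, (I.womenPref w).length) k with hK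
  set root := (List.ofFn I.opt, List.ofFn (0 : Fin I.men → ℕ)) with hroot
  have hstart : start x = (context I K, [root]) := start_eq I k
  obtain ⟨n₁, s₁, e₁, k₁, -, b₁⟩ := h₁ 0 x (initStore (Enc.enc x)) (by simp [initStore])
  rw [hstart, enc_pair] at k₁
  obtain ⟨n₂, s₂, b, e₂, k₂, hsound, hcompl, b₂⟩ := h₂ (context I K) (IsNode I)
    (fun p => ∃ μ, (I.IsStable μ ∧ I.menCost μ ≤ K ∧ I.womenCost μ ≤ K) ∧ Compatible I μ p)
    (I.Bal ≤ k) (weight I K) (4 * size x + 1)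
    (fun p hp => (size_node_le hp).trans (by
      have : size x = size k.bits + (size I.prefLists + (size I.swap.prefLists + size () + 1) + 1)
        + 1 := rfl
      omega))
    (fun p hp => isNode_child hp) (fun p => length_visit_le _ p) (fun p hp => weight_child hp)
    (fun p hp h => (bal_le_iff I k).2 (visit_sound hp h))
    (fun p hp ⟨μ, hμ, hc⟩ h => by
      obtain ⟨p', hp', hc'⟩ := visit_complete hμ.1 hμ.2.1 hμ.2.2 hp hc h
      exact ⟨p', hp', μ, hμ, hc'⟩)
    [root] (Function.update (Function.update (Function.update s₁ 1 (Enc.enc [root])) 0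
      (Enc.enc (context I K))) 2 .nil)
    (fun p hp => by
      rw [List.mem_singleton.1 hp]
      exact ⟨_, _, rfl, opt_le_length, by simp⟩)
    (by simp) (by simp) (by simp [enc_false])
  -- At the root, nobody is marked and the pointers are those of the man-optimal matching, so that
  -- every stable matching is compatible with it.
  have hans : b = true ↔ I.Bal ≤ k := by
    refine ⟨hsound, fun h => hcompl ?_⟩
    obtain ⟨μ, hμ⟩ := (bal_le_iff I k).1 h
    exact ⟨root, by simp, μ, hμ, _, _, rfl, opt_le_vec hμ.1, by simp⟩
  refine ⟨n₁ + (1 + (1 + (1 + (n₂ + 1)))), Function.update s₂ 0 (s₂ 2), e₁.seq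
    ((Exec.tl 1 0 _).seq ((Exec.hd 0 0 _).seq ((Exec.nil 2 _).seq (Exec.seq ?_
    (Exec.copy 0 2 _))))), ?_, ?_, ?_⟩
  · convert e₂ using 2
    simp [k₁, fstTree, sndTree]
  · have hsize := hr x
    rw [hstart, size_pair] at hsize
    have hq : q₂.eval (size (context I K) + (4 * size x + 1)) ≤
        (q₂.comp (r + 4 * .X + 1)).eval (size x) := by
      simp only [Polynomial.eval_comp, Polynomial.eval_add, Polynomial.eval_mul,
        Polynomial.eval_ofNat, Polynomial.eval_X, Polynomial.eval_one]
      refine eval_mono _ ?_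
      simp only at hsize
      omega
    have hW := weight_root_le I (∑ m, (I.menPref m).length + ∑ w, (I.womenPref w).length) k
    have hmul := Nat.mul_le_mul hW hq
    have hpow := Nat.one_le_pow (I.param k).toNat 8 (by norm_num)
    simp only [List.map_cons, List.map_nil, List.sum_cons, List.sum_nil, add_zero] at b₂
    change _ ≤ (q₁ + 8 * q₂.comp (r + 4 * .X + 1) + 5).eval (size x) * _
    simp only [Polynomial.eval_add, Polynomial.eval_mul, Polynomial.eval_ofNat]
    generalize (q₂.comp (r + 4 * .X + 1)).eval (size x) = Q at *
    generalize 8 ^ (I.param k).toNat = E at *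
    have := b₂.trans (Nat.add_le_add_right hmul 1)
    have : (q₁.eval (size x) + 5) * 1 ≤ (q₁.eval (size x) + 5) * E := Nat.mul_le_mul_left _ hpow
    have : (q₁.eval (size x) + 8 * Q + 5) * E = (q₁.eval (size x) + 5) * E + 8 * E * Q := by ring
    omega
  · intro h
    simp [k₂, hans.2 h, Enc.enc]
  · intro h
    have : b = false := by rwa [← hans, Bool.not_eq_true] at h
    simp [k₂, this, Enc.enc]

end BSM

/-- Above-Min BSM can be solved in time `O*(8^t)`: a single program decides `Bal ≤ k` for every
instance and every `k` in time at most `8^t` times a polynomial in the size of the input, where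
`t = k - min {O_M, O_W}` (and the time is polynomial when `t` is negative). -/
theorem theorem2 :
    ∃ (c : BSM.Prog) (p : Polynomial ℕ), ∀ (I : BSM.Instance) (k : ℕ),
      BSM.AnswersWithin c (BSM.encode I k) (I.Bal ≤ k)
        (p.eval (BSM.encode I k).numNodes * 8 ^ (I.param k).toNat) :=
  BSM.exists_prog
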